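/- Let $f_u,f_v,g_u,g_v\in\mathbb R$ and $k>0$. For $\tau\in\mathbb R$ consider the free rod eigenvalue problem on $(-1,1)$, $$u''''-\tau u''=\mu u \text{ on } (-1,1),\qquad u''=0 \text{ and } u'''-\tau u'=0 \text{ at } \pm1 .$$ For $l=0,1,2,\dots$ let $\mu_l^{\mathrm{odd}}(\tau)$ be the eigenvalues, listed in increasing order, that have odd eigenfunctions, and let $\mu_l^{\mathrm{even}}(\tau)$ be those that have even eigenfunctions of mean zero, multiplicities being counted within the respective class of eigenfunctions. (Thus the trivial branch $\mu=0$ of the constant eigenfunction is left out; even eigenfunctions with $\mu\ne0$ automatically have mean zero.) Put $$A=\frac{f_u+g_v}{1+k},\qquad a,b=\frac{(kf_u+g_v)\mp\sqrt{(kf_u+g_v)^2-4k(f_ug_v-f_vg_u)}}{2k},$$ where $a$ is taken with the minus sign and $b$ with the plus sign, and define the following regions of the half-plane $\{(R,\tau): R>0\}$: $$E_+(l)=\{(R,\tau): R^{-4}\mu_l^{\mathrm{even}}(\tau R^2)\in(a,b)\},\qquad E_-(l)=\{(R,\tau): R^{-4}\mu_l^{\mathrm{even}}(\tau R^2)<A,\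 \tau<0\},$$ and $O_\pm(l)$ in the same way with $\mu_l^{\mathrm{odd}}$ in place of $\mu_l^{\mathrm{even}}$. 1. Assume $(kf_u+g_v)^2-4k(f_ug_v-f_vg_u)>0$. Then the regions $E_+(l)$ move downwards as $l$ increases, and so do the regions $O_+(l)$. That is, for every $l\ge0$ there are continuous functions $\tau_{\mathrm{bot}}(R;l)<\tau^{\mathrm{top}}(R;l)$ of $R>0$ (the bottom and top boundary curves) such that $E_+(l)=\{(R,\tau): R>0,\ \tau_{\mathrm{bot}}(R;l)<\tau<\tau^{\mathrm{top}}(R;l)\}$, and for all $l\ge0$ and $R>0$ $$\tau^{\mathrm{top}}(R;l)>\tau^{\mathrm{top}}(R;l+1),\qquad \tau_{\mathrm{bot}}(R;l)>\tau_{\mathrm{bot}}(R;l+1);$$ the same holds for $O_+(l)$ with its own curves. 2. Assume $f_u+g_v<0$. Then the regions are strictly nested: $$E_-(0)\supsetneq E_-(1)\supsetneq E_-(2)\supsetneq\cdots,\qquad O_-(0)\supsetneq O_-(1)\supsetneq O_-(2)\supsetneq\cdots .$$ -/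

import Mathlib

open Set

noncomputable section

/-- The vector `(f_u, f_v, g_u, g_v, k)` of reaction-diffusion parameters. -/
structure ReactionParams where
  fu : ℝ
  fv : ℝ
  gu : ℝ
  gv : ℝ
  k : ℝ

namespace ReactionParams

/-- `A = (f_u + g_v) / (1 + k)`. -/
def A (p : ReactionParams) : ℝ := (p.fu + p.gv) / (1 + p.k)

/-- `(k f_u + g_v)² - 4 k (f_u g_v - f_v g_u)`. -/
def disc (p : ReactionParams) : ℝ :=
  (p.k * p.fu + p.gv) ^ 2 - 4 * p.k * (p.fu * p.gv - p.fv * p.gu)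

/-- The smaller root `a`. -/
def a (p : ReactionParams) : ℝ := (p.k * p.fu + p.gv - Real.sqrt p.disc) / (2 * p.k)

/-- The larger root `b`. -/
def b (p : ReactionParams) : ℝ := (p.k * p.fu + p.gv + Real.sqrt p.disc) / (2 * p.k)

end ReactionParams

/-- `u` is an eigenfunction with eigenvalue `μ` of the free rod on `(-1, 1)` under tension `τ`:
`u'''' - τ u'' = μ u` on `(-1, 1)`, with the natural boundary conditions `u'' = 0` and
`u''' - τ u' = 0` at `±1`. A function of class `C⁴` on `[-1, 1]` is represented by a `C⁴`
extension to the line; only its values on `[-1, 1]` matter. -/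
def IsFreeRodEigenfunction (τ μ : ℝ) (u : ℝ → ℝ) : Prop :=
  ContDiff ℝ 4 u ∧
  (∃ x ∈ Icc (-1 : ℝ) 1, u x ≠ 0) ∧
  (∀ x ∈ Ioo (-1 : ℝ) 1, iteratedDeriv 4 u x - τ * iteratedDeriv 2 u x = μ * u x) ∧
  (∀ x : ℝ, x = -1 ∨ x = 1 →
    iteratedDeriv 2 u x = 0 ∧ iteratedDeriv 3 u x - τ * iteratedDeriv 1 u x = 0)

/-- Odd on `[-1, 1]`. -/
def IsOddMode (u : ℝ → ℝ) : Prop := ∀ x ∈ Icc (-1 : ℝ) 1, u (-x) = -u x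

/-- Even on `[-1, 1]` and orthogonal to the constants. Every even eigenfunction with a nonzero
eigenvalue has mean zero, so the mean condition does nothing but discard the trivial branch
`μ = 0` of the constant eigenfunction, which is not one of the branches `μ_l^even`. -/
def IsEvenMode (u : ℝ → ℝ) : Prop :=
  (∀ x ∈ Icc (-1 : ℝ) 1, u (-x) = u x) ∧ ∫ x in (-1 : ℝ)..1, u x = 0

/-- The `l`-th (`l = 0, 1, 2, …`) free rod eigenvalue under tension `τ` among eigenfunctions with
property `P`, in increasing order and counted with multiplicity: the least `c` for which there are
`l + 1` eigenfunctions, linearly independent on `[-1, 1]`, with eigenvalues at most `c`. -/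
def rodEigenvalue (P : (ℝ → ℝ) → Prop) (l : ℕ) (τ : ℝ) : ℝ :=
  sInf {c : ℝ | ∃ (u : Fin (l + 1) → ℝ → ℝ) (ν : Fin (l + 1) → ℝ),
    (∀ i, ν i ≤ c ∧ IsFreeRodEigenfunction τ (ν i) (u i) ∧ P (u i)) ∧
    LinearIndependent ℝ (fun i (x : Icc (-1 : ℝ) 1) => u i x)}

/-- The even eigenvalue branch `μ_l^even(τ)`. -/
def muEven (l : ℕ) (τ : ℝ) : ℝ := rodEigenvalue IsEvenMode l τ

/-- The odd eigenvalue branch `μ_l^odd(τ)`. -/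
def muOdd (l : ℕ) (τ : ℝ) : ℝ := rodEigenvalue IsOddMode l τ

/-- The region `E₊(l)` in the `(R, τ)` half-plane `R > 0`. -/
def EPlus (p : ReactionParams) (l : ℕ) : Set (ℝ × ℝ) :=
  {q | 0 < q.1 ∧ (q.1 ^ 4)⁻¹ * muEven l (q.2 * q.1 ^ 2) ∈ Ioo p.a p.b}

/-- The region `O₊(l)`. -/
def OPlus (p : ReactionParams) (l : ℕ) : Set (ℝ × ℝ) :=
  {q | 0 < q.1 ∧ (q.1 ^ 4)⁻¹ * muOdd l (q.2 * q.1 ^ 2) ∈ Ioo p.a p.b}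

/-- The region `E₋(l)`. -/
def EMinus (p : ReactionParams) (l : ℕ) : Set (ℝ × ℝ) :=
  {q | 0 < q.1 ∧ (q.1 ^ 4)⁻¹ * muEven l (q.2 * q.1 ^ 2) < p.A ∧ q.2 < 0}

/-- The region `O₋(l)`. -/
def OMinus (p : ReactionParams) (l : ℕ) : Set (ℝ × ℝ) :=
  {q | 0 < q.1 ∧ (q.1 ^ 4)⁻¹ * muOdd l (q.2 * q.1 ^ 2) < p.A ∧ q.2 < 0}

/-- The graphs over `R > 0` of `bot` and `top` are the bottom and top boundary curves of the
region `S`: both are continuous, `bot < top`, and `S` consists of the points strictly between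
them. This determines `bot` and `top` on `R > 0`. -/
structure HasBoundaryCurves (S : Set (ℝ × ℝ)) (bot top : ℝ → ℝ) : Prop where
  continuous_bot : ContinuousOn bot (Ioi 0)
  continuous_top : ContinuousOn top (Ioi 0)
  bot_lt_top : ∀ R : ℝ, 0 < R → bot R < top R
  eq_between : S = {q : ℝ × ℝ | 0 < q.1 ∧ bot q.1 < q.2 ∧ q.2 < top q.1}

/-- The regions `S 0, S 1, S 2, …` move downwards: each has a top and a bottom boundary curve, and
the top (resp. bottom) curve of `S l` lies strictly above that of `S (l + 1)`. -/
def MovesDownwards (S : ℕ → Set (ℝ × ℝ)) : Prop :=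
  ∃ bot top : ℕ → ℝ → ℝ,
    (∀ l, HasBoundaryCurves (S l) (bot l) (top l)) ∧
    ∀ l, ∀ R : ℝ, 0 < R → top (l + 1) R < top l R ∧ bot (l + 1) R < bot l R

end

open Set Filter Topology MeasureTheory unitInterval

/-! The idea is to exchange the roles of the two parameters. Fix the eigenvalue `μ = c` and treat
the compressive load `θ = -τ` as the spectral parameter: on even mean-zero or on odd functions on
`[0, 1]` the weak equation is `∫ u'' v'' - c ∫ u v = θ ∫ u' v'`. Its right-hand form is compact
relative to `∫ u'' v''`, so there is a sequence `θ_0(c) ≤ θ_1(c) ≤ …` obtained by minimizing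
Rayleigh quotients.

Each `θ_l` is continuous, strictly decreasing and onto the line (`continuous_theta`,
`strictAnti_theta`, `surjective_theta`). Within a parity class, with constants removed, the rod
problem has at most one mode for given `τ` and `μ` (`exists_rel_even`, `exists_rel_odd`), so `θ_l <
θ_{l+1}` strictly (`theta_lt_succ`). Counting modes with eigenvalue at most `c` shows that `μ_l` is
the inverse function of `c ↦ -θ_l(c)` (`rodEigenvalue_eq`).

Hence `R⁻⁴ μ_l(τR²) < c` exactly when `τ < -θ_l(cR⁴)/R²`. The boundary curves are therefore
explicit; they are ordered in `c` by monotonicity of `θ_l` and in `l` by simplicity. For `A < 0` the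
curve lies in `τ < 0` because `θ_l` is positive at negative `c`, which makes the nesting strict.

Sobolev spaces are avoided by taking `u''` in `L²` (together with `u'(0)` in the odd case) as the
unknown and recovering `u'` and `u` by integration. -/

/-- Bounded operators on a Banach space `V`, with `J` compact and injective, `S` injective, and the
norm of `V` controlled by `D` and `J`. For fixed `c` they define the variational eigenvalue problem
`⟪D x, D z⟫ - c ⟪S J x, S J z⟫ = θ ⟪J x, J z⟫`. -/
structure CompactPencil (V H : Type*) [NormedAddCommGroup V] [NormedSpace ℝ V]
    [NormedAddCommGroup H] [InnerProductSpace ℝ H] where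
  D : V →L[ℝ] H
  J : V →L[ℝ] H
  S : H →L[ℝ] H
  injective_J : Function.Injective J
  injective_S : Function.Injective S
  isCompact_J : IsCompactOperator J
  coercive : ∃ C : ℝ, 0 ≤ C ∧ ∀ x, ‖x‖ ^ 2 ≤ C * (‖D x‖ ^ 2 + ‖J x‖ ^ 2)
  infinite : ¬ FiniteDimensional ℝ V

/-! ### Variational eigenvalues of a compact pencil and their dependence on `c`. -/

namespace CompactPencil

variable {V H : Type*} [NormedAddCommGroup V] [NormedSpace ℝ V]
    [NormedAddCommGroup H] [InnerProductSpace ℝ H] (P : CompactPencil V H)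

/-- The form `⟪J x, J y⟫`. -/
noncomputable def a : V →ₗ[ℝ] V →ₗ[ℝ] ℝ :=
  (innerₗ H).compl₁₂ (P.J : V →ₗ[ℝ] H) (P.J : V →ₗ[ℝ] H)

/-- The form `⟪S J x, S J y⟫`. -/
noncomputable def b : V →ₗ[ℝ] V →ₗ[ℝ] ℝ :=
  (innerₗ H).compl₁₂ ((P.S ∘L P.J : V →L[ℝ] H) : V →ₗ[ℝ] H) ((P.S ∘L P.J : V →L[ℝ] H) : V →ₗ[ℝ] H)

/-- The form `⟪D x, D y⟫`. -/
noncomputable def d : V →ₗ[ℝ] V →ₗ[ℝ] ℝ :=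
  (innerₗ H).compl₁₂ (P.D : V →ₗ[ℝ] H) (P.D : V →ₗ[ℝ] H)

/-- The form `⟪D x, D y⟫ - c ⟪S J x, S J y⟫`. -/
noncomputable def q (c : ℝ) : V →ₗ[ℝ] V →ₗ[ℝ] ℝ := P.d - c • P.b

lemma a_apply (x y : V) : P.a x y = inner ℝ (P.J x) (P.J y) := rfl
lemma b_apply (x y : V) : P.b x y = inner ℝ (P.S (P.J x)) (P.S (P.J y)) := rfl
lemma d_apply (x y : V) : P.d x y = inner ℝ (P.D x) (P.D y) := rfl
lemma q_apply (c : ℝ) (x y : V) : P.q c x y = P.d x y - c * P.b x y := rfl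

lemma a_self (x : V) : P.a x x = ‖P.J x‖ ^ 2 := by rw [a_apply, real_inner_self_eq_norm_sq]
lemma b_self (x : V) : P.b x x = ‖P.S (P.J x)‖ ^ 2 := by rw [b_apply, real_inner_self_eq_norm_sq]
lemma d_self (x : V) : P.d x x = ‖P.D x‖ ^ 2 := by rw [d_apply, real_inner_self_eq_norm_sq]

lemma a_comm (x y : V) : P.a x y = P.a y x := by rw [a_apply, a_apply, real_inner_comm]
lemma b_comm (x y : V) : P.b x y = P.b y x := by rw [b_apply, b_apply, real_inner_comm]
lemma d_comm (x y : V) : P.d x y = P.d y x := by rw [d_apply, d_apply, real_inner_comm]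
lemma q_comm (c : ℝ) (x y : V) : P.q c x y = P.q c y x := by
  rw [q_apply, q_apply, d_comm, b_comm]

lemma b_le (x : V) : P.b x x ≤ ‖P.S‖ ^ 2 * P.a x x := by
  rw [a_self, b_self, ← mul_pow]
  gcongr
  exact P.S.le_opNorm _

lemma b_nonneg (x : V) : 0 ≤ P.b x x := by rw [b_self]; positivity
lemma d_nonneg (x : V) : 0 ≤ P.d x x := by rw [d_self]; positivity

lemma a_pos {x : V} (hx : x ≠ 0) : 0 < P.a x x := by
  rw [a_self]
  have : P.J x ≠ 0 := fun h => hx (P.injective_J (by rw [h, map_zero]))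
  positivity

lemma neg_abs_le_q (c : ℝ) (x : V) : -(|c| * ‖P.S‖ ^ 2) * P.a x x ≤ P.q c x x - P.d x x := by
  rw [q_apply]
  have h1 := P.b_le x
  have h2 := P.b_nonneg x
  have : c * P.b x x ≤ |c| * (‖P.S‖ ^ 2 * P.a x x) :=
    (mul_le_mul_of_nonneg_right (le_abs_self c) h2).trans
      (mul_le_mul_of_nonneg_left h1 (abs_nonneg c))
  linarith

lemma continuous_q (c : ℝ) : Continuous fun x => P.q c x x := by
  simp only [q_apply, d_self, b_self]; fun_prop

lemma exists_subseq_J {x : ℕ → V} {M : ℝ} (hx : ∀ n, ‖x n‖ ≤ M) :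
    ∃ φ : ℕ → ℕ, StrictMono φ ∧ ∃ w, Tendsto (fun n => P.J (x (φ n))) atTop (𝓝 w) := by
  have hc := P.isCompact_J.isCompact_closure_image_closedBall M
  obtain ⟨w, -, φ, hφ, h⟩ := hc.tendsto_subseq (x := fun n => P.J (x n)) fun n =>
    subset_closure ⟨x n, by simpa using hx n, rfl⟩
  exact ⟨φ, hφ, w, h⟩

/-- The term in `c` is bounded on the sphere `‖J x‖ = 1`, so a bound on `q` bounds `D x`, and
coercivity bounds `x`. This feeds the compactness of `J`. -/
lemma exists_norm_le_of_q_le (c M : ℝ) : ∃ B : ℝ, ∀ x, ‖P.J x‖ = 1 → P.q c x x ≤ M → ‖x‖ ≤ B := by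
  obtain ⟨C, hC0, hC⟩ := P.coercive
  refine ⟨√(C * (M + |c| * ‖P.S‖ ^ 2 + 1)), fun x h1 h2 => ?_⟩
  apply Real.le_sqrt_of_sq_le
  refine (hC x).trans (mul_le_mul_of_nonneg_left ?_ hC0)
  have h3 := P.neg_abs_le_q c x
  rw [a_self, h1, d_self] at h3
  rw [h1]
  linarith

/-- The Rayleigh quotient attains its minimum on closed subspaces. -/
lemma exists_min [CompleteSpace V] (c : ℝ) (W : Submodule ℝ V) (hW : IsClosed (W : Set V))
    (hne : W ≠ ⊥) :
    ∃ x ∈ W, ‖P.J x‖ = 1 ∧ ∀ z ∈ W, P.q c x x * P.a z z ≤ P.q c z z := by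
  set A : Set ℝ := (fun z => P.q c z z) '' {z | z ∈ W ∧ ‖P.J z‖ = 1} with hA
  have normalize : ∀ z ∈ W, z ≠ 0 → (‖P.J z‖⁻¹ • z) ∈ W ∧ ‖P.J (‖P.J z‖⁻¹ • z)‖ = 1 := by
    intro z hz hz0
    have : ‖P.J z‖ ≠ 0 := norm_ne_zero_iff.2 fun h => hz0 (P.injective_J (by rw [h, map_zero]))
    refine ⟨W.smul_mem _ hz, ?_⟩
    rw [map_smul, norm_smul, norm_inv, norm_norm, inv_mul_cancel₀ this]
  have hAne : A.Nonempty := by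
    obtain ⟨z, hz, hz0⟩ := W.ne_bot_iff.1 hne
    exact ⟨_, _, normalize z hz hz0, rfl⟩
  have hAb : BddBelow A := by
    refine ⟨-(|c| * ‖P.S‖ ^ 2), ?_⟩
    rintro _ ⟨z, ⟨-, hz⟩, rfl⟩
    have h1 := P.neg_abs_le_q c z
    have h2 := P.d_nonneg z
    rw [a_self, hz] at h1
    simp only
    linarith
  obtain ⟨v, -, hv, hvA⟩ := exists_seq_tendsto_sInf hAne hAb
  choose x hx hxv using hvA
  set m := sInf A with hm
  have hmin : ∀ z ∈ W, m * P.a z z ≤ P.q c z z := by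
    intro z hz
    rcases eq_or_ne z 0 with rfl | hz0
    · simp
    have h1 := csInf_le hAb ⟨_, normalize z hz hz0, rfl⟩
    simp only [map_smul, LinearMap.smul_apply, smul_eq_mul] at h1
    have h2 : 0 < ‖P.J z‖ := norm_pos_iff.2 fun h => hz0 (P.injective_J (by rw [h, map_zero]))
    rw [a_self]
    rw [← hm, ← mul_assoc, ← mul_inv, inv_mul_eq_div, le_div_iff₀ (by positivity)] at h1
    nlinarith
  have hbdd : BddAbove (range v) := hv.bddAbove_range
  obtain ⟨M, hM⟩ := hbdd
  obtain ⟨B, hB⟩ := P.exists_norm_le_of_q_le c M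
  have hxB : ∀ n, ‖x n‖ ≤ B := fun n => hB _ (hx n).2 (by
    have := hM (mem_range_self n); rw [← hxv n] at this; exact this)
  obtain ⟨φ, hφ, w, hw⟩ := P.exists_subseq_J hxB
  obtain ⟨C, hC0, hC⟩ := P.coercive
  have hv' : Tendsto (fun n => v (φ n) - m) atTop (𝓝 0) := by
    simpa using (hv.comp hφ.tendsto_atTop).sub_const m
  -- The parallelogram law, with the lower bound `m` applied to the sum, controls `q` of the
  -- difference. Once `J` of the minimizing sequence converges, the sequence itself is Cauchy, and
  -- no weak convergence is needed.
  have key : ∀ n p, ‖x (φ n) - x (φ p)‖ ^ 2 ≤ C * (2 * (v (φ n) - m) + 2 * (v (φ p) - m) +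
      (m + |c| * ‖P.S‖ ^ 2 + 1) * ‖P.J (x (φ n)) - P.J (x (φ p))‖ ^ 2) := by
    intro n p
    refine (hC _).trans (mul_le_mul_of_nonneg_left ?_ hC0)
    have h1 := P.neg_abs_le_q c (x (φ n) - x (φ p))
    have h2 := hmin _ (W.add_mem (hx (φ n)).1 (hx (φ p)).1)
    have h3 := parallelogram_law_with_norm ℝ (P.J (x (φ n))) (P.J (x (φ p)))
    have h4 : P.q c (x (φ n) - x (φ p)) (x (φ n) - x (φ p)) =
        2 * v (φ n) + 2 * v (φ p) - P.q c (x (φ n) + x (φ p)) (x (φ n) + x (φ p)) := by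
      rw [← hxv, ← hxv]
      simp only [map_add, map_sub, LinearMap.add_apply, LinearMap.sub_apply]
      ring
    rw [(hx _).2, (hx _).2] at h3
    rw [a_self, d_self, map_sub] at h1
    rw [a_self, map_add] at h2
    have h5 : ‖P.J (x (φ n)) + P.J (x (φ p))‖ ^ 2 =
        4 - ‖P.J (x (φ n)) - P.J (x (φ p))‖ ^ 2 := by linarith
    rw [h5] at h2
    rw [map_sub P.J]
    linarith
  have hcau : CauchySeq fun n => x (φ n) := by
    rw [cauchySeq_iff_tendsto_dist_atTop_0]
    have hJ := (cauchySeq_iff_tendsto_dist_atTop_0).1 hw.cauchySeq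
    have t1 : Tendsto (fun n : ℕ × ℕ => v (φ n.1) - m) atTop (𝓝 0) := by
      rw [← prod_atTop_atTop_eq]; exact hv'.comp tendsto_fst
    have t2 : Tendsto (fun n : ℕ × ℕ => v (φ n.2) - m) atTop (𝓝 0) := by
      rw [← prod_atTop_atTop_eq]; exact hv'.comp tendsto_snd
    have t3 := ((((t1.const_mul 2).add (t2.const_mul 2)).add ((hJ.pow 2).const_mul
      (m + |c| * ‖P.S‖ ^ 2 + 1))).const_mul C).sqrt
    have h0 : √(C * (2 * 0 + 2 * 0 + (m + |c| * ‖P.S‖ ^ 2 + 1) * 0 ^ 2)) = 0 := by simp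
    rw [h0] at t3
    refine squeeze_zero (fun _ => dist_nonneg) (fun n => ?_) t3
    rw [dist_eq_norm, dist_eq_norm]
    exact Real.le_sqrt_of_sq_le (key n.1 n.2)
  obtain ⟨y, hy⟩ := cauchySeq_tendsto_of_complete hcau
  have hyW : y ∈ W := hW.mem_of_tendsto hy (Eventually.of_forall fun n => (hx _).1)
  have hyJ : ‖P.J y‖ = 1 :=
    tendsto_nhds_unique (((P.J.continuous.norm).tendsto y).comp hy)
      (by simp only [Function.comp_def, (hx _).2]; exact tendsto_const_nhds)
  have hyq : P.q c y y = m := by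
    refine tendsto_nhds_unique (((P.continuous_q c).tendsto y).comp hy) ?_
    have := hv.comp hφ.tendsto_atTop
    simp only [Function.comp_def] at this ⊢
    convert this using 2 with n
    exact hxv _
  exact ⟨y, hyW, hyJ, by rwa [hyq]⟩

/-- Euler–Lagrange equation: the variation `x + t z` gives a quadratic in `t` that is nonnegative
and vanishes at `0`, so its linear coefficient is zero. -/
lemma eq_of_min {c : ℝ} {W : Submodule ℝ V} {x : V} (hx : x ∈ W) (h1 : ‖P.J x‖ = 1)
    (hmin : ∀ z ∈ W, P.q c x x * P.a z z ≤ P.q c z z) {z : V} (hz : z ∈ W) :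
    P.q c x z = P.q c x x * P.a x z := by
  set θ := P.q c x x with hθ
  set B := P.q c x z - θ * P.a x z with hB
  set Q := P.q c z z - θ * P.a z z with hQ
  have hQ0 : 0 ≤ Q := sub_nonneg.2 (hmin z hz)
  have hxx : P.a x x = 1 := by rw [a_self, h1]; norm_num
  have key : ∀ t : ℝ, 0 ≤ t ^ 2 * Q + 2 * t * B := by
    intro t
    have h := hmin _ (W.add_mem hx (W.smul_mem t hz))
    simp only [map_add, LinearMap.add_apply, map_smul, LinearMap.smul_apply, smul_eq_mul,
      ← hθ, hxx, P.q_comm c z x, P.a_comm z x] at h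
    rw [hQ, hB]
    nlinarith
  have hB0 : B = 0 := by
    by_contra hne
    -- Near the minimizer `-B / Q`; the shift by one covers `Q = 0`.
    have h := key (-B / (Q + 1))
    have hp : 0 < Q + 1 := by linarith
    have e : (-B / (Q + 1)) ^ 2 * Q + 2 * (-B / (Q + 1)) * B = -(B ^ 2 * (Q + 2)) / (Q + 1) ^ 2 := by
      field_simp; ring
    rw [e] at h
    have : 0 < B ^ 2 := by positivity
    have : -(B ^ 2 * (Q + 2)) / (Q + 1) ^ 2 < 0 := by
      apply div_neg_of_neg_of_pos _ (by positivity)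
      nlinarith
    linarith
  linarith

/-- The vectors `a`-orthogonal to `e 0, …, e (n - 1)`. -/
noncomputable def perp {n : ℕ} (e : Fin n → V) : Submodule ℝ V := LinearMap.ker (LinearMap.pi fun i => P.a (e i))

lemma mem_perp {n : ℕ} {e : Fin n → V} {z : V} : z ∈ P.perp e ↔ ∀ i, P.a (e i) z = 0 := by
  rw [perp, LinearMap.mem_ker, funext_iff]; rfl

lemma isClosed_perp {n : ℕ} (e : Fin n → V) : IsClosed (P.perp e : Set V) := by
  have : (P.perp e : Set V) = ⋂ i, {z | P.a (e i) z = 0} := by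
    ext z; rw [SetLike.mem_coe, P.mem_perp, mem_iInter]; rfl
  rw [this]
  refine isClosed_iInter fun i => isClosed_eq ?_ continuous_const
  change Continuous fun z => inner ℝ (P.J (e i)) (P.J z)
  fun_prop

lemma perp_ne_bot {n : ℕ} (e : Fin n → V) : P.perp e ≠ ⊥ := fun h =>
  P.infinite (FiniteDimensional.of_injective _ (LinearMap.ker_eq_bot.1 h))

variable [CompleteSpace V]

/-- The eigenvectors, by successive minimization of the Rayleigh quotient. -/
noncomputable def eig (c : ℝ) : ℕ → V
  | n => (P.exists_min c (P.perp fun i : Fin n => eig c i) (P.isClosed_perp _)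
      (P.perp_ne_bot _)).choose
decreasing_by all_goals exact i.2

lemma eig_spec (c : ℝ) (n : ℕ) : P.eig c n ∈ P.perp (fun i : Fin n => P.eig c i) ∧
    ‖P.J (P.eig c n)‖ = 1 ∧ ∀ z ∈ P.perp (fun i : Fin n => P.eig c i),
      P.q c (P.eig c n) (P.eig c n) * P.a z z ≤ P.q c z z := by
  rw [eig]
  exact (P.exists_min c (P.perp fun i : Fin n => P.eig c i) (P.isClosed_perp _)
      (P.perp_ne_bot _)).choose_spec

/-- The eigenvalues, in increasing order. -/
noncomputable def theta (n : ℕ) (c : ℝ) : ℝ := P.q c (P.eig c n) (P.eig c n)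

lemma a_eig_self (c : ℝ) (n : ℕ) : P.a (P.eig c n) (P.eig c n) = 1 := by
  rw [a_self, (P.eig_spec c n).2.1]; norm_num

lemma eig_ne_zero (c : ℝ) (n : ℕ) : P.eig c n ≠ 0 := by
  intro h
  have := P.a_eig_self c n
  rw [h] at this
  simp at this

lemma a_eig_of_lt (c : ℝ) {i n : ℕ} (h : i < n) : P.a (P.eig c i) (P.eig c n) = 0 :=
  P.mem_perp.1 (P.eig_spec c n).1 ⟨i, h⟩

lemma a_eig_of_ne (c : ℝ) {i n : ℕ} (h : i ≠ n) : P.a (P.eig c i) (P.eig c n) = 0 := by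
  rcases lt_or_gt_of_ne h with h | h
  · exact P.a_eig_of_lt c h
  · rw [a_comm]; exact P.a_eig_of_lt c h

lemma theta_mul_le (c : ℝ) (n : ℕ) {z : V} (hz : ∀ i < n, P.a (P.eig c i) z = 0) :
    P.theta n c * P.a z z ≤ P.q c z z :=
  (P.eig_spec c n).2.2 z (P.mem_perp.2 fun i => hz i i.2)

/-- Minimality yields the equation only against vectors orthogonal to the earlier eigenvectors. The
projection `s` onto their span contributes nothing to either side, by symmetry and the equations
already known for them. -/
lemma q_eig (c : ℝ) (n : ℕ) (z : V) :
    P.q c (P.eig c n) z = P.theta n c * P.a (P.eig c n) z := by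
  induction n using Nat.strong_induction_on generalizing z with
  | _ n ih =>
    set s := ∑ i ∈ Finset.range n, P.a (P.eig c i) z • P.eig c i with hs
    have hmem : z - s ∈ P.perp (fun i : Fin n => P.eig c i) := by
      refine P.mem_perp.2 fun i => ?_
      rw [map_sub, hs, map_sum, Finset.sum_eq_single (i : ℕ)]
      · rw [map_smul, smul_eq_mul, a_eig_self, mul_one, sub_self]
      · intro j _ hj
        rw [map_smul, P.a_eig_of_ne c hj.symm, smul_zero]
      · intro h; exact absurd (Finset.mem_range.2 i.2) h
    have h1 := P.eq_of_min (P.eig_spec c n).1 (P.eig_spec c n).2.1 (P.eig_spec c n).2.2 hmem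
    have h2 : P.q c (P.eig c n) s = 0 := by
      rw [hs, map_sum]
      refine Finset.sum_eq_zero fun i hi => ?_
      have hi' := Finset.mem_range.1 hi
      rw [map_smul, q_comm, ih i hi', P.a_eig_of_lt c hi', mul_zero, smul_zero]
    have h3 : P.a (P.eig c n) s = 0 := by
      rw [hs, map_sum]
      refine Finset.sum_eq_zero fun i hi => ?_
      rw [map_smul, P.a_comm _ (P.eig c i), P.a_eig_of_lt c (Finset.mem_range.1 hi), smul_zero]
    rw [map_sub, map_sub, h2, h3, sub_zero, sub_zero] at h1
    exact h1

lemma theta_mono (c : ℝ) {m n : ℕ} (h : m ≤ n) : P.theta m c ≤ P.theta n c := by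
  have := P.theta_mul_le c m (z := P.eig c n) fun i hi => P.a_eig_of_lt c (hi.trans_le h)
  rwa [a_eig_self, mul_one] at this

/-- Upper half of the min-max principle: a trial space of dimension `n + 1` contains a nonzero
vector orthogonal to the first `n` eigenvectors. -/
lemma theta_le_of_linearIndependent {c t : ℝ} {n : ℕ} {x : Fin (n + 1) → V}
    (hx : LinearIndependent ℝ x)
    (h : ∀ s : Fin (n + 1) → ℝ, P.q c (∑ i, s i • x i) (∑ i, s i • x i) ≤
      t * P.a (∑ i, s i • x i) (∑ i, s i • x i)) : P.theta n c ≤ t := by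
  let f : (Fin (n + 1) → ℝ) →ₗ[ℝ] (Fin n → ℝ) :=
    (LinearMap.pi fun i : Fin n => P.a (P.eig c i)) ∘ₗ Fintype.linearCombination ℝ x
  have hf : LinearMap.ker f ≠ ⊥ := LinearMap.ker_ne_bot_of_finrank_lt (by simp)
  obtain ⟨s, hs, hs0⟩ := (Submodule.ne_bot_iff _).1 hf
  set z := ∑ i, s i • x i with hz
  have hz0 : z ≠ 0 := fun h0 => hs0 (funext (Fintype.linearIndependent_iff.1 hx s h0))
  have hzp : ∀ i < n, P.a (P.eig c i) z = 0 := by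
    intro i hi
    have := congrFun (LinearMap.mem_ker.1 hs) ⟨i, hi⟩
    simpa [f, Fintype.linearCombination_apply, hz] using this
  exact le_of_mul_le_mul_right ((P.theta_mul_le c n hzp).trans (h s)) (P.a_pos hz0)

lemma a_sum_eig (c : ℝ) (n : ℕ) (s : Fin (n + 1) → ℝ) (j : Fin (n + 1)) :
    P.a (P.eig c j) (∑ i, s i • P.eig c i) = s j := by
  rw [map_sum, Finset.sum_eq_single j]
  · rw [map_smul, a_eig_self, smul_eq_mul, mul_one]
  · intro i _ hi
    rw [map_smul, P.a_eig_of_ne c (fun h => hi (Fin.ext h.symm)), smul_zero]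
  · simp

lemma linearIndependent_eig (c : ℝ) (n : ℕ) :
    LinearIndependent ℝ fun i : Fin (n + 1) => P.eig c i := by
  refine Fintype.linearIndependent_iff.2 fun s hs i => ?_
  rw [← P.a_sum_eig c n s i, hs, map_zero]

lemma q_le_theta_mul (c : ℝ) (n : ℕ) (s : Fin (n + 1) → ℝ) :
    P.q c (∑ i, s i • P.eig c i) (∑ i, s i • P.eig c i) ≤
      P.theta n c * P.a (∑ i, s i • P.eig c i) (∑ i, s i • P.eig c i) := by
  set z := ∑ i, s i • P.eig c i with hz
  have h1 : P.q c z z = ∑ i : Fin (n + 1), P.theta i c * s i ^ 2 := by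
    nth_rw 2 [hz]
    rw [map_sum]
    refine Finset.sum_congr rfl fun i _ => ?_
    rw [map_smul, q_comm, q_eig, hz, a_sum_eig, smul_eq_mul]; ring
  have h2 : P.a z z = ∑ i, s i ^ 2 := by
    nth_rw 2 [hz]
    rw [map_sum]
    refine Finset.sum_congr rfl fun i _ => ?_
    rw [map_smul, a_comm, hz, a_sum_eig, smul_eq_mul]; ring
  rw [h1, h2, Finset.mul_sum]
  gcongr with i
  exact P.theta_mono c (Nat.lt_succ_iff.1 i.2)

/-- The eigenvectors at `c'` serve as trial space at `c`, and `b ≤ ‖S‖² a` bounds the change of the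
form. -/
lemma theta_le_add (n : ℕ) {c c' : ℝ} (h : c ≤ c') :
    P.theta n c ≤ P.theta n c' + ‖P.S‖ ^ 2 * (c' - c) := by
  refine P.theta_le_of_linearIndependent (P.linearIndependent_eig c' n) fun s => ?_
  have h1 := P.q_le_theta_mul c' n s
  set z := ∑ i, s i • P.eig c' i
  have h2 := mul_le_mul_of_nonneg_left (P.b_le z) (sub_nonneg.2 h)
  rw [q_apply] at h1 ⊢
  linarith

/-- The eigenvectors at `c` serve as trial space for every `c' ≥ c`. On this finite-dimensional
space `S J` is injective, so `b` dominates a positive multiple of `a`. As the slope `m` does not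
depend on `c'`, the estimate gives both strict decrease and divergence to `-∞`. -/
lemma exists_theta_le_sub (n : ℕ) (c : ℝ) :
    ∃ m > 0, ∀ c', c ≤ c' → P.theta n c' ≤ P.theta n c - m * (c' - c) := by
  let f : (Fin (n + 1) → ℝ) →ₗ[ℝ] H :=
    ((P.S ∘L P.J : V →L[ℝ] H) : V →ₗ[ℝ] H) ∘ₗ
      Fintype.linearCombination ℝ (fun i : Fin (n + 1) => P.eig c i)
  have hli : LinearMap.ker f = ⊥ := by
    rw [LinearMap.ker_eq_bot]
    exact (P.injective_S.comp P.injective_J).comp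
      (P.linearIndependent_eig c n).fintypeLinearCombination_injective
  obtain ⟨K, hK0, hK⟩ := f.exists_antilipschitzWith hli
  let g : (Fin (n + 1) → ℝ) →L[ℝ] H :=
    LinearMap.toContinuousLinearMap ((P.J : V →ₗ[ℝ] H) ∘ₗ
      Fintype.linearCombination ℝ (fun i : Fin (n + 1) => P.eig c i))
  have hb : ∀ s : Fin (n + 1) → ℝ, P.a (∑ i, s i • P.eig c i) (∑ i, s i • P.eig c i) ≤
      ((‖g‖ + 1) * K) ^ 2 * P.b (∑ i, s i • P.eig c i) (∑ i, s i • P.eig c i) := by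
    intro s
    have h1 : ‖s‖ ≤ K * ‖f s‖ := by
      simpa using hK.le_mul_dist s 0
    have h2 : ‖g s‖ ≤ ‖g‖ * ‖s‖ := g.le_opNorm s
    have h3 : f s = P.S (P.J (∑ i, s i • P.eig c i)) := by
      simp [f, Fintype.linearCombination_apply]
    have h4 : g s = P.J (∑ i, s i • P.eig c i) := by
      simp [g, Fintype.linearCombination_apply]
    rw [a_self, b_self, ← h3, ← h4, ← mul_pow]
    gcongr
    calc ‖g s‖ ≤ ‖g‖ * ‖s‖ := h2
      _ ≤ (‖g‖ + 1) * (K * ‖f s‖) := by gcongr; linarith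
      _ = _ := by ring
  have hK0' : (0 : ℝ) < K := hK0
  set G := ((‖g‖ + 1) * K) ^ 2 with hG
  have hG0 : 0 < G := by positivity
  refine ⟨G⁻¹, by positivity, fun c' hc => ?_⟩
  refine P.theta_le_of_linearIndependent (P.linearIndependent_eig c n) fun s => ?_
  have h1 := P.q_le_theta_mul c n s
  have h2 := hb s
  set z := ∑ i, s i • P.eig c i
  have h3 : G⁻¹ * P.a z z ≤ P.b z z := by
    rw [inv_mul_le_iff₀ hG0]; exact h2
  have h4 := mul_le_mul_of_nonneg_left h3 (sub_nonneg.2 hc)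
  rw [q_apply] at h1 ⊢
  linarith

lemma strictAnti_theta (n : ℕ) : StrictAnti (P.theta n) := by
  intro c c' h
  obtain ⟨m, hm, h1⟩ := P.exists_theta_le_sub n c
  have := h1 c' h.le
  nlinarith [mul_pos hm (sub_pos.2 h)]

lemma continuous_theta (n : ℕ) : Continuous (P.theta n) := by
  have : LipschitzWith (‖P.S‖₊ ^ 2) (P.theta n) := by
    refine LipschitzWith.of_le_add_mul _ fun x y => ?_
    rcases le_total x y with h | h
    · have := P.theta_le_add n h
      rw [Real.dist_eq, abs_sub_comm, abs_of_nonneg (sub_nonneg.2 h)]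
      simpa using this
    · have := (P.strictAnti_theta n).antitone h
      have h2 : 0 ≤ ((‖P.S‖₊ ^ 2 : NNReal) : ℝ) * dist x y := by positivity
      linarith
  exact this.continuous

lemma tendsto_theta_atTop (n : ℕ) : Tendsto (P.theta n) atTop atBot := by
  obtain ⟨m, hm, h1⟩ := P.exists_theta_le_sub n 0
  have h2 : Tendsto (fun c' : ℝ => P.theta n 0 - m * (c' - 0)) atTop atBot := by
    simp only [sub_zero]
    simp only [sub_eq_add_neg]
    exact tendsto_atBot_add_const_left _ _
      (tendsto_neg_atTop_atBot.comp (tendsto_id.const_mul_atTop hm))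
  exact tendsto_atBot_mono' _ ((eventually_ge_atTop 0).mono fun c hc => h1 c hc) h2

/-- Ehrling's inequality, in terms of the lowest eigenvalue. -/
lemma exists_lt_theta_zero (M : ℝ) : ∃ c, M < P.theta 0 c := by
  by_contra! hcon
  -- If `θ_0` were bounded by `M`, the ground states at `c = -n` would satisfy `d + n b ≤ M`. A
  -- limit `w` of their images under `J` would have norm one and yet `S w = 0`.
  set x : ℕ → V := fun n => P.eig (-(n : ℝ)) 0 with hxdef
  have h1 : ∀ n, ‖P.J (x n)‖ = 1 := fun n => (P.eig_spec _ 0).2.1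
  have h2 : ∀ n : ℕ, P.d (x n) (x n) + n * P.b (x n) (x n) ≤ M := by
    intro n
    have := hcon (-(n : ℝ))
    rw [theta, q_apply] at this
    linarith
  obtain ⟨B, hB⟩ := P.exists_norm_le_of_q_le 0 M
  have hxB : ∀ n, ‖x n‖ ≤ B := fun n => hB _ (h1 n) (by
    rw [q_apply]
    have := h2 n
    have h3 : 0 ≤ (n : ℝ) * P.b (x n) (x n) := mul_nonneg n.cast_nonneg (P.b_nonneg _)
    linarith)
  obtain ⟨φ, hφ, w, hw⟩ := P.exists_subseq_J hxB
  have hw1 : ‖w‖ = 1 :=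
    tendsto_nhds_unique hw.norm (by simp only [h1]; exact tendsto_const_nhds)
  have hSw := ((P.S.continuous.tendsto w).comp hw).norm.pow 2
  have hS0 : Tendsto (fun n => P.b (x (φ n)) (x (φ n))) atTop (𝓝 0) := by
    have hlim : Tendsto (fun n : ℕ => M / (φ n : ℝ)) atTop (𝓝 0) :=
      (tendsto_const_div_atTop_nhds_zero_nat M).comp hφ.tendsto_atTop
    refine squeeze_zero' (Eventually.of_forall fun n => P.b_nonneg _) ?_ hlim
    filter_upwards [hφ.tendsto_atTop.eventually_gt_atTop 0] with n hn
    rw [le_div_iff₀ (by exact_mod_cast hn)]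
    have := h2 (φ n)
    have h3 := P.d_nonneg (x (φ n))
    linarith
  have : ‖P.S w‖ ^ 2 = 0 := tendsto_nhds_unique hSw (by
    simp only [Function.comp_def, ← b_self]; exact hS0)
  have hw0 : w = 0 := P.injective_S (by
    rw [map_zero]; exact norm_eq_zero.1 (pow_eq_zero_iff (two_ne_zero)|>.1 this))
  rw [hw0] at hw1
  simp at hw1

lemma tendsto_theta_atBot (n : ℕ) : Tendsto (P.theta n) atBot atTop := by
  refine tendsto_atTop.2 fun M => ?_
  obtain ⟨c, hc⟩ := P.exists_lt_theta_zero M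
  filter_upwards [eventually_le_atBot c] with c' hc'
  exact hc.le.trans (((P.strictAnti_theta 0).antitone hc').trans (P.theta_mono c' (Nat.zero_le n)))

lemma surjective_theta (n : ℕ) : Function.Surjective (P.theta n) :=
  (P.continuous_theta n).surjective' (P.tendsto_theta_atBot n) (P.tendsto_theta_atTop n)

end CompactPencil

/-- Real `L²` functions on the unit interval. -/
abbrev UnitL2 : Type := Lp ℝ 2 (volume : Measure I)

/-! ### The Volterra operator on `L²(0, 1)`: compactness, adjoint, injectivity. -/

namespace UnitL2

/-- This makes `cls` injective: continuous functions equal almost everywhere are equal. -/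
instance : (volume : Measure I).IsOpenPosMeasure where
  open_pos U hU hne h := by
    obtain ⟨V, hV, rfl⟩ := isOpen_induced_iff.1 hU
    obtain ⟨x, hx⟩ := hne
    rw [unitInterval.volume_apply, Subtype.image_preimage_coe] at h
    -- The given point may be an endpoint; density supplies one in the open interval.
    have hx1 : (x : ℝ) ∈ closure (Ioo (0 : ℝ) 1) := by
      rw [closure_Ioo zero_ne_one]; exact x.2
    obtain ⟨y, hyV, hy⟩ := mem_closure_iff.1 hx1 V hV hx
    refine (hV.inter isOpen_Ioo).measure_ne_zero volume ⟨y, hyV, hy⟩ (measure_mono_null ?_ h)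
    rintro z ⟨hz1, hz2⟩
    exact ⟨Ioo_subset_Icc_self hz2, hz1⟩

/-- The `L²` class of a continuous function. -/
noncomputable def cls : C(I, ℝ) →L[ℝ] UnitL2 := ContinuousMap.toLp 2 volume ℝ

/-- The extension of a function on the unit interval by its end values. -/
noncomputable def ext (f : C(I, ℝ)) : ℝ → ℝ := IccExtend zero_le_one f

@[fun_prop]
lemma continuous_ext (f : C(I, ℝ)) : Continuous (ext f) := f.continuous.Icc_extend'

lemma ext_coe (f : C(I, ℝ)) (x : I) : ext f x = f x := IccExtend_val _ _ x

lemma integral_coe (g : ℝ → ℝ) : ∫ x : I, g x = ∫ x in (0 : ℝ)..1, g x := by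
  rw [unitInterval.measurePreserving_coe.integral_comp unitInterval.measurableEmbedding_coe,
    intervalIntegral.integral_of_le zero_le_one, unitInterval, integral_Icc_eq_integral_Ioc]

lemma cls_injective : Function.Injective cls := ContinuousMap.toLp_injective _

lemma inner_cls (f g : C(I, ℝ)) :
    inner ℝ (cls f) (cls g) = ∫ x in (0 : ℝ)..1, ext f x * ext g x := by
  rw [← integral_coe, cls, ContinuousMap.inner_toLp]
  simp only [ext_coe, conj_trivial, mul_comm]

/-- The constant function `1`. -/
noncomputable def one : UnitL2 := cls 1

/-- The indicator of `[0, x]`. -/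
noncomputable def ind (x : I) : UnitL2 :=
  indicatorConstLp 2 (measurableSet_Iic (a := x)) (measure_ne_top _ _) (1 : ℝ)

lemma norm_ind_le (x : I) : ‖ind x‖ ≤ 1 := by
  rw [ind, norm_indicatorConstLp (by simp) (by simp), norm_one, one_mul]
  exact Real.rpow_le_one measureReal_nonneg (measureReal_le_one) (by simp)

/-- The symmetric difference of two such initial intervals lies between their endpoints, so its
measure is at most their distance. -/
lemma continuous_ind : Continuous ind := by
  refine continuous_indicatorConstLp_set (by simp) fun x => ?_
  have h : Tendsto (fun y : I => edist y x) (𝓝 x) (𝓝 0) := by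
    have : Continuous fun y : I => edist y x := by fun_prop
    simpa using this.tendsto x
  refine tendsto_of_tendsto_of_tendsto_of_le_of_le tendsto_const_nhds h (fun _ => zero_le) ?_
  intro y
  change _ ≤ edist y x
  rw [← unitInterval.volume_uIcc]
  refine measure_mono ?_
  rintro z (⟨h1, h2⟩ | ⟨h1, h2⟩)
  · simp only [mem_Iic, not_le] at h1 h2
    exact ⟨inf_le_iff.2 (Or.inl h2.le), le_sup_iff.2 (Or.inr h1)⟩
  · simp only [mem_Iic, not_le] at h1 h2
    exact ⟨inf_le_iff.2 (Or.inr h2.le), le_sup_iff.2 (Or.inl h1)⟩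

/-- The primitive vanishing at `0`, as a continuous function. -/
noncomputable def prim : UnitL2 →L[ℝ] C(I, ℝ) :=
  LinearMap.mkContinuous
    { toFun := fun y => ⟨fun x => inner ℝ (ind x) y, continuous_ind.inner continuous_const⟩
      map_add' := fun y z => by ext x; simp [inner_add_right]
      map_smul' := fun r y => by ext x; simp [inner_smul_right] } 1 (fun y => by
      rw [one_mul]
      refine (ContinuousMap.norm_le _ (norm_nonneg _)).2 fun x => ?_
      refine (norm_inner_le_norm (𝕜 := ℝ) (ind x) y).trans ?_
      exact mul_le_of_le_one_left (norm_nonneg _) (norm_ind_le x))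

lemma prim_apply (y : UnitL2) (x : I) : prim y x = inner ℝ (ind x) y := rfl

lemma prim_zero (y : UnitL2) : prim y 0 = 0 := by
  have : ind 0 = 0 := by
    rw [← norm_eq_zero, ind, norm_indicatorConstLp (by simp) (by simp), measureReal_def,
      unitInterval.volume_Iic]
    simp
  rw [prim_apply, this, inner_zero_left]

lemma prim_one (y : UnitL2) : prim y 1 = inner ℝ one y := by
  have : ind 1 = one := by
    rw [ind, one, cls]
    refine Lp.ext ?_
    filter_upwards [indicatorConstLp_coeFn (p := 2) (hs := measurableSet_Iic (a := (1 : I)))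
      (hμs := measure_ne_top volume _) (c := (1 : ℝ)),
      ContinuousMap.coeFn_toLp (p := 2) (𝕜 := ℝ) (volume : Measure I) (1 : C(I, ℝ))] with t h1 h2
    rw [h1, h2, indicator_of_mem (mem_Iic.2 unitInterval.le_one')]
    rfl
  rw [prim_apply, this]

lemma prim_cls (f : C(I, ℝ)) (x : I) : prim (cls f) x = ∫ t in (0 : ℝ)..x, ext f t := by
  rw [prim_apply, ind, L2.inner_indicatorConstLp_one, cls]
  have h1 : ∫ t in Iic x, (ContinuousMap.toLp 2 volume ℝ f : UnitL2) t =
      ∫ t in Iic x, f t :=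
    setIntegral_congr_ae measurableSet_Iic
      ((ContinuousMap.coeFn_toLp (p := 2) (𝕜 := ℝ) (volume : Measure I) f).mono fun _ h _ => h)
  have h2 : ∫ t in Iic x, f t = ∫ t : I, (Iic (x : ℝ)).indicator (ext f) t := by
    rw [← integral_indicator measurableSet_Iic]
    refine integral_congr_ae (Eventually.of_forall fun t => ?_)
    by_cases ht : t ≤ x
    · simp only
      rw [indicator_of_mem (show t ∈ Iic x from ht), indicator_of_mem (show (t : ℝ) ∈ Iic (x : ℝ) from ht),
        ext_coe]
    · simp only
      rw [indicator_of_notMem (show t ∉ Iic x from ht),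
        indicator_of_notMem (show (t : ℝ) ∉ Iic (x : ℝ) from ht)]
  rw [h1, h2, integral_coe, intervalIntegral.integral_of_le zero_le_one,
    intervalIntegral.integral_of_le x.2.1, setIntegral_indicator measurableSet_Iic]
  congr 2
  ext t
  simp only [mem_inter_iff, mem_Ioc, mem_Iic]
  have := x.2.2
  constructor
  · rintro ⟨⟨a, b⟩, c⟩; exact ⟨a, c⟩
  · rintro ⟨a, c⟩; exact ⟨⟨a, c.trans this⟩, c⟩

lemma hasDerivAt_integral {g : ℝ → ℝ} (hg : Continuous g) (x : ℝ) :
    HasDerivAt (fun u => ∫ t in (0 : ℝ)..u, g t) (g x) x :=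
  intervalIntegral.integral_hasDerivAt_right (hg.intervalIntegrable _ _)
    (hg.stronglyMeasurableAtFilter _ _) hg.continuousAt

lemma ext_prim_cls (f : C(I, ℝ)) {x : ℝ} (hx : x ∈ Icc (0 : ℝ) 1) :
    ext (prim (cls f)) x = ∫ t in (0 : ℝ)..x, ext f t := by
  rw [← prim_cls f ⟨x, hx⟩, ← ext_coe]

lemma hasDerivWithinAt_prim (f : C(I, ℝ)) {x : ℝ} (hx : x ∈ Icc (0 : ℝ) 1) :
    HasDerivWithinAt (ext (prim (cls f))) (ext f x) (Icc 0 1) x :=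
  (hasDerivAt_integral (continuous_ext f) x).hasDerivWithinAt.congr
    (fun _ hy => ext_prim_cls f hy) (ext_prim_cls f hx)

/-- The Volterra operator on `L²`. -/
noncomputable def volterra : UnitL2 →L[ℝ] UnitL2 := cls ∘L prim

lemma volterra_apply (y : UnitL2) : volterra y = cls (prim y) := rfl

/-- Arzelà–Ascoli: the map `x ↦ ind x` provides one modulus of continuity for the primitives of the
whole unit ball. -/
lemma isCompact_volterra : IsCompactOperator volterra := by
  have h : IsCompactOperator
      ((ContinuousMap.linearIsometryBoundedOfCompact I ℝ ℝ).toContinuousLinearEquiv ∘ prim) := by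
    let L : UnitL2 →L[ℝ] BoundedContinuousFunction I ℝ :=
      ((ContinuousMap.linearIsometryBoundedOfCompact I ℝ ℝ).toContinuousLinearEquiv :
        C(I, ℝ) →L[ℝ] _) ∘L prim
    change IsCompactOperator L
    refine (isCompactOperator_iff_isCompact_closure_image_closedBall
      (L : UnitL2 →ₗ[ℝ] BoundedContinuousFunction I ℝ) one_pos).2 ?_
    refine BoundedContinuousFunction.arzela_ascoli (Metric.closedBall 0 1)
      (isCompact_closedBall _ _) _ ?_ ?_
    · rintro _ x ⟨y, hy, rfl⟩
      rw [mem_closedBall_zero_iff] at hy ⊢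
      change ‖inner ℝ (ind x) y‖ ≤ 1
      exact (norm_inner_le_norm _ _).trans
        (mul_le_one₀ (norm_ind_le x) (norm_nonneg _) hy)
    · intro x
      rw [Metric.equicontinuousAt_iff_right]
      intro ε hε
      have h1 := (Metric.continuous_iff'.1 continuous_ind) x ε hε
      filter_upwards [h1] with z hz
      rintro ⟨_, y, hy, rfl⟩
      rw [mem_closedBall_zero_iff] at hy
      change dist (inner ℝ (ind x) y) (inner ℝ (ind z) y) < ε
      rw [dist_eq_norm, ← inner_sub_left]
      rw [dist_comm, dist_eq_norm] at hz
      exact ((norm_inner_le_norm _ _).trans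
        (mul_le_of_le_one_right (norm_nonneg _) hy)).trans_lt hz
  have h2 := h.clm_comp (cls ∘L
    ((ContinuousMap.linearIsometryBoundedOfCompact I ℝ ℝ).toContinuousLinearEquiv.symm :
      _ →L[ℝ] C(I, ℝ)))
  convert! h2 using 1

lemma denseRange_cls : DenseRange cls := ContinuousMap.toLp_denseRange ℝ volume ℝ (by simp)

lemma ext_one (x : ℝ) : ext 1 x = 1 := rfl

/-- Integration by parts for continuous functions, extended by density. -/
lemma inner_volterra_add (f g : UnitL2) :
    inner ℝ (volterra f) g + inner ℝ f (volterra g) = inner ℝ one f * inner ℝ one g := by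
  refine denseRange_cls.induction_on₂ (p := fun f g =>
    inner ℝ (volterra f) g + inner ℝ f (volterra g) = inner ℝ one f * inner ℝ one g) ?_ ?_ f g
  · exact isClosed_eq (by fun_prop) (by fun_prop)
  · intro f g
    rw [volterra_apply, volterra_apply, one, inner_cls, inner_cls, inner_cls, inner_cls]
    simp only [ext_one, one_mul]
    have h1 : ∫ x in (0 : ℝ)..1, ext (prim (cls f)) x * ext g x =
        ∫ x in (0 : ℝ)..1, (∫ t in (0 : ℝ)..x, ext f t) * ext g x := by
      refine intervalIntegral.integral_congr fun x hx => ?_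
      rw [uIcc_of_le zero_le_one] at hx
      simp only [ext_prim_cls f hx]
    have h2 : ∫ x in (0 : ℝ)..1, ext f x * ext (prim (cls g)) x =
        ∫ x in (0 : ℝ)..1, ext f x * (∫ t in (0 : ℝ)..x, ext g t) := by
      refine intervalIntegral.integral_congr fun x hx => ?_
      rw [uIcc_of_le zero_le_one] at hx
      simp only [ext_prim_cls g hx]
    have c1 : Continuous fun x => ∫ t in (0 : ℝ)..x, ext f t :=
      continuous_iff_continuousAt.2 fun x => (hasDerivAt_integral (continuous_ext f) x).continuousAt
    have c2 : Continuous fun x => ∫ t in (0 : ℝ)..x, ext g t :=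
      continuous_iff_continuousAt.2 fun x => (hasDerivAt_integral (continuous_ext g) x).continuousAt
    have i1 : IntervalIntegrable (fun x => (∫ t in (0 : ℝ)..x, ext f t) * ext g x) volume 0 1 :=
      (c1.mul (continuous_ext g)).intervalIntegrable _ _
    have i2 : IntervalIntegrable (fun x => ext f x * (∫ t in (0 : ℝ)..x, ext g t)) volume 0 1 :=
      ((continuous_ext f).mul c2).intervalIntegrable _ _
    rw [h1, h2, ← intervalIntegral.integral_add i1 i2]
    have h3 := intervalIntegral.integral_eq_sub_of_hasDerivAt (a := 0) (b := 1)
      (fun x _ => (hasDerivAt_integral (continuous_ext f) x).mul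
        (hasDerivAt_integral (continuous_ext g) x))
      (((continuous_ext f).mul c2).add (c1.mul (continuous_ext g)) |>.intervalIntegrable _ _)
    simp only [Pi.mul_apply, intervalIntegral.integral_same, zero_mul, sub_zero] at h3
    rw [← h3]
    exact intervalIntegral.integral_congr fun x _ => add_comm _ _

/-- The adjoint of the Volterra operator. -/
noncomputable def volterraAdj : UnitL2 →L[ℝ] UnitL2 := (innerSL ℝ one).smulRight one - volterra

lemma volterraAdj_apply (f : UnitL2) : volterraAdj f = inner ℝ one f • one - volterra f := rfl

lemma inner_volterraAdj (f g : UnitL2) : inner ℝ (volterraAdj f) g = inner ℝ f (volterra g) := by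
  rw [volterraAdj_apply, inner_sub_left, inner_smul_left, conj_trivial, ← inner_volterra_add]
  ring

lemma inner_one_one : inner ℝ one one = (1 : ℝ) := by
  rw [one, inner_cls]; simp [ext_one]

lemma polynomial_mem (p : Polynomial ℝ) :
    cls (p.toContinuousMapOn I) = p.eval 0 • one +
      volterra (cls ((Polynomial.derivative p).toContinuousMapOn I)) := by
  rw [volterra_apply, one, ← map_smul, ← map_add]
  congr 1
  ext x
  have hder : ∀ t ∈ uIcc (0 : ℝ) x, HasDerivAt (fun t => p.eval t) (p.derivative.eval t) t :=
    fun t _ => p.hasDerivAt t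
  have hint : ∫ t in (0 : ℝ)..x, ext ((Polynomial.derivative p).toContinuousMapOn I) t =
      ∫ t in (0 : ℝ)..x, p.derivative.eval t := by
    refine intervalIntegral.integral_congr fun t ht => ?_
    rw [uIcc_of_le x.2.1] at ht
    exact ext_coe _ (⟨t, ht.1, ht.2.trans x.2.2⟩ : I)
  rw [ContinuousMap.add_apply, prim_cls, hint, intervalIntegral.integral_eq_sub_of_hasDerivAt hder
    (p.derivative.continuous.intervalIntegrable _ _)]
  simp

/-- If the primitive of `y` vanishes, then `y` is orthogonal to constants and, by parts, to all
primitives. Hence it is orthogonal to all polynomials, which are dense. -/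
lemma volterra_injective : Function.Injective volterra := by
  refine (injective_iff_map_eq_zero volterra).2 fun y hy => ?_
  have hp : prim y = 0 := cls_injective (by rw [map_zero]; exact hy)
  have h1 : inner ℝ one y = (0 : ℝ) := by rw [← prim_one, hp]; rfl
  have h2 : ∀ g, inner ℝ y (volterra g) = (0 : ℝ) := fun g => by
    have := inner_volterra_add y g
    rwa [hy, h1, inner_zero_left, zero_mul, zero_add] at this
  have h3 : ∀ f : C(I, ℝ), inner ℝ y (cls f) = (0 : ℝ) := by
    have hcl : IsClosed {f : C(I, ℝ) | inner ℝ y (cls f) = (0 : ℝ)} :=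
      isClosed_eq (by fun_prop) continuous_const
    have hsub : (polynomialFunctions I : Set C(I, ℝ)) ⊆ {f | inner ℝ y (cls f) = (0 : ℝ)} := by
      intro f hf
      rw [polynomialFunctions_coe] at hf
      obtain ⟨p, rfl⟩ := hf
      change inner ℝ y (cls (p.toContinuousMapOn I)) = (0 : ℝ)
      rw [polynomial_mem, inner_add_right, inner_smul_right, h2, real_inner_comm, h1]
      ring
    intro f
    have hf : f ∈ (polynomialFunctions I).topologicalClosure := by
      rw [polynomialFunctions_closure_eq_top']; trivial
    exact hcl.closure_subset_iff.2 hsub hf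
  have h4 : ∀ g : UnitL2, inner ℝ y g = (0 : ℝ) := fun g =>
    denseRange_cls.induction_on (p := fun g => inner ℝ y g = (0 : ℝ)) g
      (isClosed_eq (by fun_prop) continuous_const) h3
  exact inner_self_eq_zero.1 (h4 y)

lemma not_finiteDimensional : ¬ FiniteDimensional ℝ UnitL2 := by
  intro h
  let L : Polynomial ℝ →ₗ[ℝ] UnitL2 := (cls : C(I, ℝ) →ₗ[ℝ] UnitL2) ∘ₗ
    (Polynomial.toContinuousMapOnAlgHom I).toLinearMap
  have hL : Function.Injective L := by
    refine cls_injective.comp ?_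
    intro p r hpr
    refine Polynomial.eq_of_infinite_eval_eq p r ?_
    refine (Icc_infinite (zero_lt_one (α := ℝ))).mono fun x hx => ?_
    exact DFunLike.congr_fun (show p.toContinuousMapOn I = r.toContinuousMapOn I from hpr) ⟨x, hx⟩
  exact Polynomial.not_finite (R := ℝ) (Module.Finite.of_injective L hL)

end UnitL2

/-! ### The rod equation as a linear system on `[0, 1]`. -/

/-- The first-order system of the rod equation for `(u, u', u'', u''')`. -/
noncomputable def rodField (τ μ : ℝ) : (Fin 4 → ℝ) →L[ℝ] (Fin 4 → ℝ) :=
  LinearMap.toContinuousLinearMap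
    { toFun := fun v => ![v 1, v 2, v 3, τ * v 2 + μ * v 0]
      map_add' := fun v w => by ext i; fin_cases i <;> (simp; try ring)
      map_smul' := fun r v => by ext i; fin_cases i <;> (simp; try ring) }

lemma rodField_apply (τ μ : ℝ) (v : Fin 4 → ℝ) :
    rodField τ μ v = ![v 1, v 2, v 3, τ * v 2 + μ * v 0] := rfl

/-- `X = (u, u', u'', u''')` solves the rod equation on `[0, 1]`. -/
def IsRodSolution (τ μ : ℝ) (X : ℝ → Fin 4 → ℝ) : Prop :=
  ∀ x ∈ Icc (0 : ℝ) 1, HasDerivWithinAt X (rodField τ μ (X x)) (Icc 0 1) x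

/-- The conditions at `0` and at `1` satisfied by `(u, u', u'', u''')` when `u` is a mode of the
free rod with `u (-x) = s * u x`. -/
structure IsHalfMode (s τ μ : ℝ) (X : ℝ → Fin 4 → ℝ) : Prop where
  sol : IsRodSolution τ μ X
  end_two : X 1 2 = 0
  end_three : X 1 3 = τ * X 1 1
  start_zero : s * X 0 0 = X 0 0
  start_one : -s * X 0 1 = X 0 1
  start_two : s * X 0 2 = X 0 2
  start_three : -s * X 0 3 = X 0 3

namespace IsRodSolution

variable {τ μ : ℝ} {X Y : ℝ → Fin 4 → ℝ}

lemma continuousOn (h : IsRodSolution τ μ X) : ContinuousOn X (Icc 0 1) :=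
  fun x hx => (h x hx).continuousWithinAt

lemma coord (h : IsRodSolution τ μ X) {x : ℝ} (hx : x ∈ Icc (0 : ℝ) 1) (i : Fin 4) :
    HasDerivWithinAt (fun x => X x i) (rodField τ μ (X x) i) (Icc 0 1) x :=
  hasDerivWithinAt_pi.1 (h x hx) i

lemma continuousOn_coord (h : IsRodSolution τ μ X) (i : Fin 4) :
    ContinuousOn (fun x => X x i) (Icc 0 1) :=
  fun _ hx => (h.coord hx i).continuousWithinAt

lemma eqOn_of_start (hX : IsRodSolution τ μ X) (hY : IsRodSolution τ μ Y) (h : X 0 = Y 0) :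
    EqOn X Y (Icc 0 1) :=
  ODE_solution_unique_of_mem_Icc_right (v := fun _ => rodField τ μ) (s := fun _ => univ)
    (fun _ _ => (rodField τ μ).lipschitz.lipschitzOnWith) hX.continuousOn
    (fun t ht => (hX t (Ico_subset_Icc_self ht)).mono_of_mem_nhdsWithin
      (Icc_mem_nhdsGE_of_mem ht)) (fun _ _ => mem_univ _)
    hY.continuousOn
    (fun t ht => (hY t (Ico_subset_Icc_self ht)).mono_of_mem_nhdsWithin
      (Icc_mem_nhdsGE_of_mem ht)) (fun _ _ => mem_univ _) h

lemma eqOn_of_end (hX : IsRodSolution τ μ X) (hY : IsRodSolution τ μ Y) (h : X 1 = Y 1) :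
    EqOn X Y (Icc 0 1) :=
  ODE_solution_unique_of_mem_Icc_left (v := fun _ => rodField τ μ) (s := fun _ => univ)
    (fun _ _ => (rodField τ μ).lipschitz.lipschitzOnWith) hX.continuousOn
    (fun t ht => (hX t (Ioc_subset_Icc_self ht)).mono_of_mem_nhdsWithin
      (Icc_mem_nhdsLE_of_mem ht)) (fun _ _ => mem_univ _)
    hY.continuousOn
    (fun t ht => (hY t (Ioc_subset_Icc_self ht)).mono_of_mem_nhdsWithin
      (Icc_mem_nhdsLE_of_mem ht)) (fun _ _ => mem_univ _) h

lemma zero : IsRodSolution τ μ 0 := fun x _ => by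
  change HasDerivWithinAt (fun _ => (0 : Fin 4 → ℝ)) (rodField τ μ 0) _ _
  rw [map_zero]
  exact hasDerivWithinAt_const _ _ _

lemma lin (hX : IsRodSolution τ μ X) (hY : IsRodSolution τ μ Y) (α β : ℝ) :
    IsRodSolution τ μ (fun x => α • X x + β • Y x) := fun x hx => by
  rw [map_add, map_smul, map_smul]
  exact ((hX x hx).const_smul α).add ((hY x hx).const_smul β)

/-- The coefficients are constant, so the derivative of a solution is again a solution. -/
lemma map (hX : IsRodSolution τ μ X) : IsRodSolution τ μ (fun x => rodField τ μ (X x)) :=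
  fun x hx => (rodField τ μ).hasFDerivAt.comp_hasDerivWithinAt x (hX x hx)

lemma eqOn_zero_of_start (hX : IsRodSolution τ μ X) (h : X 0 = 0) : EqOn X 0 (Icc 0 1) :=
  hX.eqOn_of_start zero h

lemma eqOn_zero_of_end (hX : IsRodSolution τ μ X) (h : X 1 = 0) : EqOn X 0 (Icc 0 1) :=
  hX.eqOn_of_end zero h

end IsRodSolution

lemma eq_value_at_one_of_hasDerivWithinAt_zero {f : ℝ → ℝ}
    (hd : ∀ y ∈ Icc (0 : ℝ) 1, HasDerivWithinAt f 0 (Icc 0 1) y) {x : ℝ}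
    (hx : x ∈ Icc (0 : ℝ) 1) : f x = f 1 :=
  (convex_Icc (0 : ℝ) 1).is_const_of_fderivWithin_eq_zero (𝕜 := ℝ)
    (fun y hy => (hd y hy).differentiableWithinAt) (fun y hy => by
      have h := (hd y hy).hasFDerivWithinAt.fderivWithin (uniqueDiffOn_Icc zero_lt_one y hy)
      rw [h]; ext; simp) hx (right_mem_Icc.2 zero_le_one)

lemma exists_smul_add_smul_eq_zero {p q r t : ℝ} (h : p * t = q * r) :
    ∃ α β : ℝ, (α ≠ 0 ∨ β ≠ 0) ∧ α * p + β * r = 0 ∧ α * q + β * t = 0 := by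
  by_cases h0 : r = 0 ∧ p = 0
  · by_cases h1 : t = 0 ∧ q = 0
    · exact ⟨1, 0, Or.inl one_ne_zero, by simp [h0.2], by simp [h1.2]⟩
    · refine ⟨t, -q, ?_, by simp [h0.1, h0.2], by ring⟩
      rw [not_and_or] at h1
      simpa using h1
  · refine ⟨r, -p, ?_, by ring, by linarith⟩
    rw [not_and_or] at h0
    simpa using h0

/-! ### Simplicity of the modes in a parity class, and Green's identity. -/

namespace IsHalfMode

variable {s τ μ ν : ℝ} {X Y : ℝ → Fin 4 → ℝ}

/-- If the second derivative of a mode is a combination of modes, the mode vanishes. -/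
lemma eqOn_zero (hμ : μ ≠ 0) (hX : IsHalfMode s τ μ X) (hY : IsHalfMode s τ μ Y) {α β : ℝ}
    (h : rodField τ μ (rodField τ μ (X 0)) = α • X 0 + β • Y 0) : EqOn X 0 (Icc 0 1) := by
  -- By uniqueness `u''` is the same combination of the two modes throughout, so it satisfies the
  -- end conditions too. With the equation, these become `μ u(1) = 0` and `μ u'(1) = 0`, so all data
  -- at `1` vanish.
  have h1 := hX.sol.map.map.eqOn_of_start (hX.sol.lin hY.sol α β) h
    (right_mem_Icc.2 zero_le_one)
  have h2 := congrFun h1 2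
  have h3 := congrFun h1 3
  have h4 := congrFun h1 1
  simp only [rodField_apply, Pi.add_apply, Pi.smul_apply, smul_eq_mul, hX.end_two, hY.end_two,
    hX.end_three, hY.end_three, Matrix.cons_val] at h2 h3 h4
  have e0 : X 1 0 = 0 := by
    have : μ * X 1 0 = 0 := by linarith
    exact (mul_eq_zero.1 this).resolve_left hμ
  have e1 : X 1 1 = 0 := by
    have : μ * X 1 1 = 0 := by linear_combination h3 - τ * h4
    exact (mul_eq_zero.1 this).resolve_left hμ
  refine hX.sol.eqOn_zero_of_end ?_
  ext i
  fin_cases i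
  · exact e0
  · exact e1
  · exact hX.end_two
  · simp [hX.end_three, e1]

lemma eqOn_zero_of_start (hX : IsHalfMode s τ μ X) (hY : IsHalfMode s τ μ Y) {α β : ℝ}
    (h : α • X 0 + β • Y 0 = 0) : EqOn (fun x => α • X x + β • Y x) 0 (Icc 0 1) :=
  (hX.sol.lin hY.sol α β).eqOn_zero_of_start h

lemma exists_rel_even_of_ne_zero (hμ : μ ≠ 0) (hX : IsHalfMode 1 τ μ X)
    (hY : IsHalfMode 1 τ μ Y) : ∃ α β : ℝ, (α ≠ 0 ∨ β ≠ 0) ∧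
      EqOn (fun x => α • X x + β • Y x) 0 (Icc 0 1) := by
  have x1 : X 0 1 = 0 := by linarith [hX.start_one]
  have x3 : X 0 3 = 0 := by linarith [hX.start_three]
  have y1 : Y 0 1 = 0 := by linarith [hY.start_one]
  have y3 : Y 0 3 = 0 := by linarith [hY.start_three]
  by_cases hdet : X 0 0 * Y 0 2 = X 0 2 * Y 0 0
  · obtain ⟨α, β, h0, h1, h2⟩ := exists_smul_add_smul_eq_zero hdet
    refine ⟨α, β, h0, eqOn_zero_of_start hX hY ?_⟩
    ext i
    fin_cases i <;> simp [x1, x3, y1, y3, h1, h2]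
  -- Independent data `(u(0), u''(0))` span all even data, including those of the second derivative
  -- of the first mode. Cramer's rule gives the coefficients for `eqOn_zero`, which makes that mode
  -- vanish.
  · obtain ⟨Δ, hΔ⟩ : ∃ Δ, Δ = X 0 0 * Y 0 2 - X 0 2 * Y 0 0 := ⟨_, rfl⟩
    have hd : Δ ≠ 0 := hΔ ▸ sub_ne_zero.2 hdet
    refine ⟨1, 0, Or.inl one_ne_zero, ?_⟩
    have := hX.eqOn_zero hμ hY
      (α := (X 0 2 * Y 0 2 - (τ * X 0 2 + μ * X 0 0) * Y 0 0) / Δ)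
      (β := (X 0 0 * (τ * X 0 2 + μ * X 0 0) - X 0 2 * X 0 2) / Δ) (by
        ext i
        fin_cases i
        · simp [rodField_apply]
          field_simp
          rw [hΔ]
          ring
        · simp [rodField_apply, x1, x3, y1]
        · simp [rodField_apply]
          field_simp
          rw [hΔ]
          ring
        · simp [rodField_apply, x1, x3, y3])
    simpa using this

lemma exists_rel_odd_of_ne_zero (hμ : μ ≠ 0) (hX : IsHalfMode (-1) τ μ X)
    (hY : IsHalfMode (-1) τ μ Y) : ∃ α β : ℝ, (α ≠ 0 ∨ β ≠ 0) ∧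
      EqOn (fun x => α • X x + β • Y x) 0 (Icc 0 1) := by
  have x0 : X 0 0 = 0 := by linarith [hX.start_zero]
  have x2 : X 0 2 = 0 := by linarith [hX.start_two]
  have y0 : Y 0 0 = 0 := by linarith [hY.start_zero]
  have y2 : Y 0 2 = 0 := by linarith [hY.start_two]
  by_cases hdet : X 0 1 * Y 0 3 = X 0 3 * Y 0 1
  · obtain ⟨α, β, h0, h1, h2⟩ := exists_smul_add_smul_eq_zero hdet
    refine ⟨α, β, h0, eqOn_zero_of_start hX hY ?_⟩
    ext i
    fin_cases i <;> simp [x0, x2, y0, y2, h1, h2]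
  · obtain ⟨Δ, hΔ⟩ : ∃ Δ, Δ = X 0 1 * Y 0 3 - X 0 3 * Y 0 1 := ⟨_, rfl⟩
    have hd : Δ ≠ 0 := hΔ ▸ sub_ne_zero.2 hdet
    refine ⟨1, 0, Or.inl one_ne_zero, ?_⟩
    have := hX.eqOn_zero hμ hY
      (α := (X 0 3 * Y 0 3 - (τ * X 0 3 + μ * X 0 1) * Y 0 1) / Δ)
      (β := (X 0 1 * (τ * X 0 3 + μ * X 0 1) - X 0 3 * X 0 3) / Δ) (by
        ext i
        fin_cases i
        · simp [rodField_apply, x0, x2, y0]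
        · simp [rodField_apply]
          field_simp
          rw [hΔ]
          ring
        · simp [rodField_apply, x0, x2, y2]
        · simp [rodField_apply]
          field_simp
          rw [hΔ]
          ring)
    simpa using this

/-- At `μ = 0` the shear force `u''' - τ u'` vanishes identically. -/
lemma shear_eq_zero (hX : IsHalfMode s τ 0 X) {x : ℝ} (hx : x ∈ Icc (0 : ℝ) 1) :
    X x 3 = τ * X x 1 := by
  have hd : ∀ y ∈ Icc (0 : ℝ) 1, HasDerivWithinAt (fun x => X x 3 - τ * X x 1) 0 (Icc 0 1) y := by
    intro y hy
    have := (hX.sol.coord hy 3).sub ((hX.sol.coord hy 1).const_mul τ)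
    convert! this using 1
    simp [rodField_apply]
  have := eq_value_at_one_of_hasDerivWithinAt_zero hd hx
  simp only [hX.end_three, sub_self] at this
  linarith

lemma exists_rel_odd (hX : IsHalfMode (-1) τ μ X) (hY : IsHalfMode (-1) τ μ Y) :
    ∃ α β : ℝ, (α ≠ 0 ∨ β ≠ 0) ∧ EqOn (fun x => α • X x + β • Y x) 0 (Icc 0 1) := by
  by_cases hμ : μ = 0
  · subst hμ
    have x0 : X 0 0 = 0 := by linarith [hX.start_zero]
    have x2 : X 0 2 = 0 := by linarith [hX.start_two]
    have y0 : Y 0 0 = 0 := by linarith [hY.start_zero]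
    have y2 : Y 0 2 = 0 := by linarith [hY.start_two]
    have x3 := hX.shear_eq_zero (left_mem_Icc.2 zero_le_one)
    have y3 := hY.shear_eq_zero (left_mem_Icc.2 zero_le_one)
    -- The argument through `u''` needs `μ ≠ 0`. Here zero shear makes `u'''(0)` a fixed multiple of
    -- `u'(0)`, which leaves a single free datum.
    have hdet : X 0 1 * Y 0 3 = X 0 3 * Y 0 1 := by rw [x3, y3]; ring
    obtain ⟨α, β, h0, h1, h2⟩ := exists_smul_add_smul_eq_zero hdet
    refine ⟨α, β, h0, eqOn_zero_of_start hX hY ?_⟩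
    ext i
    fin_cases i <;> simp [x0, x2, y0, y2, h1, h2]
  · exact exists_rel_odd_of_ne_zero hμ hX hY

/-- Zero shear integrates to `u'' = τ u - τ u(1)`; integrate once more over `[0, 1]` using mean zero
and `u'(0) = 0`. The data at `1` then depend on `u(1)` alone, so the mean condition restores
simplicity at `μ = 0`. -/
lemma end_one_of_mean_zero (hX : IsHalfMode 1 τ 0 X) (hm : ∫ x in (0 : ℝ)..1, X x 0 = 0) :
    X 1 1 = -τ * X 1 0 := by
  have x1 : X 0 1 = 0 := by linarith [hX.start_one]
  have hd : ∀ y ∈ Icc (0 : ℝ) 1, HasDerivWithinAt (fun x => X x 2 - τ * X x 0) 0 (Icc 0 1) y := by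
    intro y hy
    have := (hX.sol.coord hy 2).sub ((hX.sol.coord hy 0).const_mul τ)
    convert! this using 1
    simp [rodField_apply, hX.shear_eq_zero hy]
  have h2 : ∀ x ∈ Icc (0 : ℝ) 1, X x 2 = τ * X x 0 - τ * X 1 0 := by
    intro x hx
    have := eq_value_at_one_of_hasDerivWithinAt_zero hd hx
    simp only [hX.end_two] at this
    linarith
  have i0 : IntervalIntegrable (fun x => X x 0) volume 0 1 :=
    (by simpa [uIcc_of_le] using hX.sol.continuousOn_coord 0 :
      ContinuousOn (fun x => X x 0) (uIcc 0 1)).intervalIntegrable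
  have h3 := intervalIntegral.integral_eq_sub_of_hasDerivAt_of_le zero_le_one
    (hX.sol.continuousOn_coord 1)
    (fun x hx => (hX.sol.coord (Ioo_subset_Icc_self hx) 1).hasDerivAt (Icc_mem_nhds hx.1 hx.2))
    ((by simpa [uIcc_of_le, rodField_apply] using hX.sol.continuousOn_coord 2 :
      ContinuousOn (fun x => rodField τ 0 (X x) 1) (uIcc 0 1)).intervalIntegrable)
  have h4 : ∫ x in (0 : ℝ)..1, rodField τ 0 (X x) 1 =
      ∫ x in (0 : ℝ)..1, (τ * X x 0 - τ * X 1 0) := by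
    refine intervalIntegral.integral_congr fun x hx => ?_
    rw [uIcc_of_le zero_le_one] at hx
    simpa [rodField_apply] using h2 x hx
  rw [h4, intervalIntegral.integral_sub (i0.const_mul τ) intervalIntegrable_const,
    intervalIntegral.integral_const_mul, hm] at h3
  simp [x1] at h3
  linarith

lemma exists_rel_even (hX : IsHalfMode 1 τ μ X) (hY : IsHalfMode 1 τ μ Y)
    (hXm : ∫ x in (0 : ℝ)..1, X x 0 = 0) (hYm : ∫ x in (0 : ℝ)..1, Y x 0 = 0) :
    ∃ α β : ℝ, (α ≠ 0 ∨ β ≠ 0) ∧ EqOn (fun x => α • X x + β • Y x) 0 (Icc 0 1) := by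
  by_cases hμ : μ = 0
  · subst hμ
    have x1 := hX.end_one_of_mean_zero hXm
    have y1 := hY.end_one_of_mean_zero hYm
    have hdet : X 1 0 * Y 1 1 = X 1 1 * Y 1 0 := by rw [x1, y1]; ring
    obtain ⟨α, β, h0, h1, h2⟩ := exists_smul_add_smul_eq_zero hdet
    refine ⟨α, β, h0, (hX.sol.lin hY.sol α β).eqOn_zero_of_end ?_⟩
    ext i
    fin_cases i
    · simpa using h1
    · simpa using h2
    · simp [hX.end_two, hY.end_two]
    · simp [hX.end_three, hY.end_three]
      linear_combination τ * h2
  · exact exists_rel_even_of_ne_zero hμ hX hY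

/-- Green's identity. -/
lemma green (hs : s = 1 ∨ s = -1) (hX : IsHalfMode s τ μ X) (hY : IsHalfMode s τ ν Y) :
    (∫ x in (0 : ℝ)..1, X x 2 * Y x 2) + τ * (∫ x in (0 : ℝ)..1, X x 1 * Y x 1) =
      μ * ∫ x in (0 : ℝ)..1, X x 0 * Y x 0 := by
  have ci : ∀ i : Fin 4, IntervalIntegrable (fun x => X x i * Y x i) volume 0 1 := fun i =>
    ((hX.sol.continuousOn_coord i).mul
      (hY.sol.continuousOn_coord i)).intervalIntegrable_of_Icc zero_le_one
  have hd : ∀ x ∈ Icc (0 : ℝ) 1, HasDerivWithinAt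
      (fun x => X x 2 * Y x 1 - (X x 3 - τ * X x 1) * Y x 0)
      (X x 2 * Y x 2 + τ * (X x 1 * Y x 1) - μ * (X x 0 * Y x 0)) (Icc 0 1) x := by
    intro x hx
    have := ((hX.sol.coord hx 2).mul (hY.sol.coord hx 1)).sub
      (((hX.sol.coord hx 3).sub ((hX.sol.coord hx 1).const_mul τ)).mul (hY.sol.coord hx 0))
    convert! this using 1
    simp [rodField_apply]
    ring
  have h := intervalIntegral.integral_eq_sub_of_hasDerivAt_of_le zero_le_one
    (fun x hx => (hd x hx).continuousWithinAt)
    (fun x hx => (hd x (Ioo_subset_Icc_self hx)).hasDerivAt (Icc_mem_nhds hx.1 hx.2))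
    (((ci 2).add ((ci 1).const_mul τ)).sub ((ci 0).const_mul μ))
  rw [intervalIntegral.integral_sub ((ci 2).add ((ci 1).const_mul τ)) ((ci 0).const_mul μ),
    intervalIntegral.integral_add (ci 2) ((ci 1).const_mul τ),
    intervalIntegral.integral_const_mul, intervalIntegral.integral_const_mul] at h
  -- The boundary term at `0` vanishes by parity, the one at `1` by the natural conditions.
  have h0 : X 0 2 * Y 0 1 - (X 0 3 - τ * X 0 1) * Y 0 0 = 0 := by
    rcases hs with rfl | rfl
    · have x1 : X 0 1 = 0 := by linarith [hX.start_one]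
      have x3 : X 0 3 = 0 := by linarith [hX.start_three]
      have y1 : Y 0 1 = 0 := by linarith [hY.start_one]
      simp [x1, x3, y1]
    · have x2 : X 0 2 = 0 := by linarith [hX.start_two]
      have y0 : Y 0 0 = 0 := by linarith [hY.start_zero]
      simp [x2, y0]
  have h1 : X 1 2 * Y 1 1 - (X 1 3 - τ * X 1 1) * Y 1 0 = 0 := by
    rw [hX.end_two, hX.end_three]; ring
  rw [h0, h1] at h
  linarith

end IsHalfMode

/-! ### Passage between half modes on `[0, 1]` and eigenfunctions on `[-1, 1]`. -/

/-- The primitive of `φ` with value `a` at `0`. -/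
noncomputable def primitiveFrom (a : ℝ) (φ : ℝ → ℝ) (x : ℝ) : ℝ := a + ∫ t in (0 : ℝ)..x, φ t

lemma hasDerivAt_primitiveFrom (a : ℝ) {φ : ℝ → ℝ} (hφ : Continuous φ) (x : ℝ) :
    HasDerivAt (primitiveFrom a φ) (φ x) x :=
  (UnitL2.hasDerivAt_integral hφ x).const_add a

lemma continuous_primitiveFrom (a : ℝ) {φ : ℝ → ℝ} (hφ : Continuous φ) :
    Continuous (primitiveFrom a φ) :=
  continuous_iff_continuousAt.2 fun x => (hasDerivAt_primitiveFrom a hφ x).continuousAt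

lemma primitiveFrom_neg {a s : ℝ} {φ : ℝ → ℝ} (h : ∀ x, φ (-x) = s * φ x) (ha : -s * a = a)
    (x : ℝ) : primitiveFrom a φ (-x) = -s * primitiveFrom a φ x := by
  have h1 := intervalIntegral.integral_comp_neg φ (a := 0) (b := x)
  simp only [h, neg_zero, intervalIntegral.integral_const_mul] at h1
  rw [primitiveFrom, primitiveFrom, intervalIntegral.integral_symm, ← h1, mul_add, ha]
  ring

lemma primitiveFrom_eqOn {f g φ : ℝ → ℝ} (hd : ∀ x ∈ Icc (0 : ℝ) 1, HasDerivWithinAt f (g x) (Icc 0 1) x)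
    (hg : ContinuousOn g (Icc 0 1)) (hφ : EqOn φ g (Icc 0 1)) :
    EqOn (primitiveFrom (f 0) φ) f (Icc 0 1) := by
  intro x hx
  have hsub : Icc 0 x ⊆ Icc (0 : ℝ) 1 := Icc_subset_Icc_right hx.2
  have h := intervalIntegral.integral_eq_sub_of_hasDerivAt_of_le hx.1
    (fun y hy => (hd y (hsub hy)).continuousWithinAt.mono hsub)
    (fun y hy => (hd y (hsub (Ioo_subset_Icc_self hy))).hasDerivAt
      (Icc_mem_nhds hy.1 (hy.2.trans_le hx.2)))
    ((by simpa [uIcc_of_le hx.1] using hg.mono hsub :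
      ContinuousOn g (uIcc 0 x)).intervalIntegrable)
  have h2 : ∫ t in (0 : ℝ)..x, φ t = ∫ t in (0 : ℝ)..x, g t := by
    refine intervalIntegral.integral_congr fun t ht => hφ (hsub ?_)
    rwa [uIcc_of_le hx.1] at ht
  rw [primitiveFrom, h2, h]
  ring

/-- A half mode is the restriction of a `C⁴` function of the same parity. -/
lemma IsHalfMode.exists_extension {s τ μ : ℝ} {X : ℝ → Fin 4 → ℝ} (hs : s * s = 1)
    (hX : IsHalfMode s τ μ X) : ∃ u : ℝ → ℝ, ContDiff ℝ 4 u ∧ (∀ x, u (-x) = s * u x) ∧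
      (∀ k : Fin 4, ∀ x ∈ Icc (0 : ℝ) 1, iteratedDeriv k u x = X x k) ∧
      ∀ x ∈ Icc (-1 : ℝ) 1, iteratedDeriv 4 u x = τ * iteratedDeriv 2 u x + μ * u x := by
  set h : ℝ → ℝ := fun x => τ * X x 2 + μ * X x 0 with hh
  have hcont : ContinuousOn h (Icc 0 1) :=
    ((hX.sol.continuousOn_coord 2).const_smul τ).add ((hX.sol.continuousOn_coord 0).const_smul μ)
  set p : ℝ → ℝ := fun x => max 0 (min 1 x) with hp
  have hpI : ∀ x, p x ∈ Icc (0 : ℝ) 1 := fun x =>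
    ⟨le_max_left _ _, max_le zero_le_one (min_le_left _ _)⟩
  have hpc : Continuous p := by fun_prop
  have hhp : Continuous fun x => h (p x) := hcont.comp_continuous hpc hpI
  have hs0 : s * h 0 = h 0 := by
    simp only [hh]; linear_combination τ * hX.start_two + μ * hX.start_zero
  -- The fourth derivative, extended to the line: the clamp `p` keeps it continuous, the
  -- symmetrization gives parity `s`, and `s * h 0 = h 0` makes it agree with `h` on `[0, 1]`. Four
  -- integrations then produce `u`.
  set φ : ℝ → ℝ := fun x => h (p x) + s * h (p (-x)) - h 0 with hφ
  have hφc : Continuous φ :=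
    (hhp.add (continuous_const.mul (hhp.comp continuous_neg))).sub continuous_const
  have hφn : ∀ x, φ (-x) = s * φ x := fun x => by
    simp only [hφ, neg_neg]; linear_combination -h (p (-x)) * hs + hs0
  have hφe : EqOn φ h (Icc 0 1) := fun x hx => by
    have h1 : p x = x := by simp [hp, hx.1, hx.2]
    have h2 : p (-x) = 0 := by
      simp only [hp]; exact max_eq_left ((min_le_right _ _).trans (neg_nonpos.2 hx.1))
    simp only [hφ, h1, h2]; linarith
  set u3 := primitiveFrom (X 0 3) φ with hu3
  set u2 := primitiveFrom (X 0 2) u3 with hu2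
  set u1 := primitiveFrom (X 0 1) u2 with hu1
  set u0 := primitiveFrom (X 0 0) u1 with hu0
  have c3 : Continuous u3 := continuous_primitiveFrom _ hφc
  have c2 : Continuous u2 := continuous_primitiveFrom _ c3
  have c1 : Continuous u1 := continuous_primitiveFrom _ c2
  have c0 : Continuous u0 := continuous_primitiveFrom _ c1
  have n3 : ∀ x, u3 (-x) = -s * u3 x := primitiveFrom_neg hφn hX.start_three
  have n2 : ∀ x, u2 (-x) = s * u2 x := fun x => by
    simpa using primitiveFrom_neg n3 (by simpa using hX.start_two) x
  have n1 : ∀ x, u1 (-x) = -s * u1 x := primitiveFrom_neg n2 hX.start_one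
  have n0 : ∀ x, u0 (-x) = s * u0 x := fun x => by
    simpa using primitiveFrom_neg n1 (by simpa using hX.start_zero) x
  have e3 : EqOn u3 (fun x => X x 3) (Icc 0 1) :=
    primitiveFrom_eqOn (f := fun x => X x 3) (g := h) (fun x hx => hX.sol.coord hx 3) hcont hφe
  have e2 : EqOn u2 (fun x => X x 2) (Icc 0 1) :=
    primitiveFrom_eqOn (f := fun x => X x 2) (fun x hx => hX.sol.coord hx 2)
      (hX.sol.continuousOn_coord 3) e3
  have e1 : EqOn u1 (fun x => X x 1) (Icc 0 1) :=
    primitiveFrom_eqOn (f := fun x => X x 1) (fun x hx => hX.sol.coord hx 1)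
      (hX.sol.continuousOn_coord 2) e2
  have e0 : EqOn u0 (fun x => X x 0) (Icc 0 1) :=
    primitiveFrom_eqOn (f := fun x => X x 0) (fun x hx => hX.sol.coord hx 0)
      (hX.sol.continuousOn_coord 1) e1
  have d0 : iteratedDeriv 1 u0 = u1 := by
    rw [iteratedDeriv_one]; exact funext fun x => (hasDerivAt_primitiveFrom _ c1 x).deriv
  have d1 : iteratedDeriv 2 u0 = u2 := by
    rw [iteratedDeriv_succ, d0]; exact funext fun x => (hasDerivAt_primitiveFrom _ c2 x).deriv
  have d2 : iteratedDeriv 3 u0 = u3 := by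
    rw [iteratedDeriv_succ, d1]; exact funext fun x => (hasDerivAt_primitiveFrom _ c3 x).deriv
  have d3 : iteratedDeriv 4 u0 = φ := by
    rw [iteratedDeriv_succ, d2]; exact funext fun x => (hasDerivAt_primitiveFrom _ hφc x).deriv
  refine ⟨u0, ?_, n0, ?_, ?_⟩
  · rw [show (4 : WithTop ℕ∞) = ((4 : ℕ) : ℕ∞) from rfl, contDiff_iff_iteratedDeriv]
    constructor
    · intro m hm
      have hm' : m ≤ 4 := by exact_mod_cast hm
      interval_cases m
      · simpa using c0
      · rwa [d0]
      · rwa [d1]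
      · rwa [d2]
      · rwa [d3]
    · intro m hm
      have hm' : m < 4 := by exact_mod_cast hm
      interval_cases m
      · rw [iteratedDeriv_zero]
        exact fun x => (hasDerivAt_primitiveFrom _ c1 x).differentiableAt
      · rw [d0]; exact fun x => (hasDerivAt_primitiveFrom _ c2 x).differentiableAt
      · rw [d1]; exact fun x => (hasDerivAt_primitiveFrom _ c3 x).differentiableAt
      · rw [d2]; exact fun x => (hasDerivAt_primitiveFrom _ hφc x).differentiableAt
  · intro k x hx
    fin_cases k
    · simpa using e0 hx
    · simpa [d0] using e1 hx
    · simpa [d1] using e2 hx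
    · simpa [d2] using e3 hx
  · have pos : ∀ x ∈ Icc (0 : ℝ) 1, φ x = τ * u2 x + μ * u0 x := fun x hx => by
      rw [hφe hx, e2 hx, e0 hx]
    intro x hx
    rw [d3, d1]
    rcases le_total 0 x with h0 | h0
    · exact pos x ⟨h0, hx.2⟩
    · have h1 := pos (-x) ⟨by linarith, by linarith [hx.1]⟩
      rw [hφn, n2, n0] at h1
      linear_combination s * h1 - (φ x - τ * u2 x - μ * u0 x) * hs

lemma IsHalfMode.isFreeRodEigenfunction {s τ μ : ℝ} {X : ℝ → Fin 4 → ℝ} (hs : s * s = 1)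
    (hX : IsHalfMode s τ μ X) (hne : ∃ x ∈ Icc (0 : ℝ) 1, X x 0 ≠ 0) :
    ∃ u : ℝ → ℝ, IsFreeRodEigenfunction τ μ u ∧ (∀ x, u (-x) = s * u x) ∧
      ∀ x ∈ Icc (0 : ℝ) 1, u x = X x 0 := by
  obtain ⟨u, h1, h2, h3, h4⟩ := hX.exists_extension hs
  have h0 : ∀ x ∈ Icc (0 : ℝ) 1, u x = X x 0 := fun x hx => by simpa using h3 0 x hx
  refine ⟨u, ⟨h1, ?_, fun x hx => ?_, ?_⟩, h2, h0⟩
  · obtain ⟨x, hx, hx0⟩ := hne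
    exact ⟨x, ⟨by linarith [hx.1], hx.2⟩, by rwa [h0 x hx]⟩
  · rw [h4 x (Ioo_subset_Icc_self hx)]; ring
  · have m1 : (1 : ℝ) ∈ Icc (0 : ℝ) 1 := right_mem_Icc.2 zero_le_one
    have k1 : iteratedDeriv 1 u 1 = X 1 1 := h3 1 1 m1
    have k2 : iteratedDeriv 2 u 1 = X 1 2 := h3 2 1 m1
    have k3 : iteratedDeriv 3 u 1 = X 1 3 := h3 3 1 m1
    have hneg : ∀ k : ℕ, (k : WithTop ℕ∞) ≤ 4 →
        (-1) ^ k * iteratedDeriv k u (-1) = s * iteratedDeriv k u 1 := by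
      intro k hk
      have := iteratedDeriv_comp_neg k u 1
      rw [← smul_eq_mul, ← this]
      have e : (fun x => u (-x)) = fun x => s * u x := funext h2
      rw [e, iteratedDeriv_const_mul_field]
    intro x hx
    rcases hx with rfl | rfl
    · have n1 := hneg 1 (by norm_cast)
      have n2 := hneg 2 (by norm_cast)
      have n3 := hneg 3 (by norm_cast)
      rw [k1] at n1
      rw [k2, hX.end_two] at n2
      rw [k3, hX.end_three] at n3
      norm_num at n1 n2 n3
      exact ⟨n2, by rw [iteratedDeriv_one]; linear_combination -n3 + τ * n1⟩
    · rw [k1, k2, k3, hX.end_two, hX.end_three]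
      simp

/-- The equation extends to the endpoints by continuity, and the conditions at `0` come from
differentiating the parity relation there. -/
lemma IsFreeRodEigenfunction.isHalfMode {s τ μ : ℝ} {u : ℝ → ℝ}
    (hu : IsFreeRodEigenfunction τ μ u) (hpar : ∀ x ∈ Icc (-1 : ℝ) 1, u (-x) = s * u x) :
    IsHalfMode s τ μ (fun x k => iteratedDeriv k u x) := by
  obtain ⟨hc, -, heq, hbc⟩ := hu
  have hder : ∀ k : ℕ, k < 4 → ∀ x, HasDerivAt (iteratedDeriv k u) (iteratedDeriv (k + 1) u x) x := by
    intro k hk x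
    rw [iteratedDeriv_succ]
    exact ((hc.differentiable_iteratedDeriv k (by exact_mod_cast hk)) x).hasDerivAt
  have hcon : ∀ k : ℕ, k ≤ 4 → Continuous (iteratedDeriv k u) := fun k hk =>
    hc.continuous_iteratedDeriv k (by exact_mod_cast hk)
  have heq' : ∀ x ∈ Icc (-1 : ℝ) 1, iteratedDeriv 4 u x = τ * iteratedDeriv 2 u x + μ * u x := by
    have hcl : IsClosed {x | iteratedDeriv 4 u x = τ * iteratedDeriv 2 u x + μ * u x} :=
      isClosed_eq (hcon 4 le_rfl) ((continuous_const.mul (hcon 2 (by norm_num))).add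
        (continuous_const.mul hc.continuous))
    have := hcl.closure_subset_iff.2 (fun x hx => by
      have := heq x hx
      change _ = _; linarith : Ioo (-1 : ℝ) 1 ⊆ _)
    rwa [closure_Ioo (by norm_num)] at this
  have hzero : ∀ k : ℕ, (-1) ^ k * iteratedDeriv k u 0 = s * iteratedDeriv k u 0 := by
    intro k
    have h1 := iteratedDeriv_comp_neg k u 0
    rw [neg_zero] at h1
    rw [← smul_eq_mul, ← h1]
    have e : (fun x => u (-x)) =ᶠ[𝓝 0] fun x => s * u x := by
      filter_upwards [Icc_mem_nhds (by norm_num : (-1 : ℝ) < 0) one_pos] with x hx using hpar x hx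
    rw [e.iteratedDeriv_eq, iteratedDeriv_const_mul_field]
  have hb := hbc 1 (Or.inr rfl)
  have z0 := hzero 0
  have z1 := hzero 1
  have z2 := hzero 2
  have z3 := hzero 3
  norm_num at z0 z1 z2 z3
  refine ⟨fun x hx => ?_, hb.1, ?_, ?_, ?_, ?_, ?_⟩
  · refine hasDerivWithinAt_pi.2 fun i => ?_
    have hx' : x ∈ Icc (-1 : ℝ) 1 := ⟨by linarith [hx.1], hx.2⟩
    fin_cases i
    · exact (hder 0 (by norm_num) x).hasDerivWithinAt
    · exact (hder 1 (by norm_num) x).hasDerivWithinAt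
    · exact (hder 2 (by norm_num) x).hasDerivWithinAt
    · have := (hder 3 (by norm_num) x).hasDerivWithinAt (s := Icc 0 1)
      rw [heq' x hx'] at this
      simpa [rodField_apply] using this
  · have := hb.2
    simp only [Fin.isValue, Fin.val_one]
    change iteratedDeriv 3 u 1 = τ * iteratedDeriv 1 u 1
    linarith
  · simpa using z0.symm
  · simp; linarith
  · change s * iteratedDeriv 2 u 0 = iteratedDeriv 2 u 0; linarith
  · change -s * iteratedDeriv 3 u 0 = iteratedDeriv 3 u 0; linarith

lemma CompactPencil.b_pos {V H : Type*} [NormedAddCommGroup V] [NormedSpace ℝ V]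
    [NormedAddCommGroup H] [InnerProductSpace ℝ H] (P : CompactPencil V H) {x : V} (hx : x ≠ 0) :
    0 < P.b x x := by
  rw [b_self]
  have : P.S (P.J x) ≠ 0 := fun h =>
    hx (P.injective_J (P.injective_S (by rw [h, map_zero, map_zero])))
  positivity

/-- For `c < 0` the form `q` is positive definite. This places the level curves for `A < 0` in the
half-plane `τ < 0`. -/
lemma CompactPencil.theta_pos {V H : Type*} [NormedAddCommGroup V] [NormedSpace ℝ V]
    [NormedAddCommGroup H] [InnerProductSpace ℝ H] [CompleteSpace V] (P : CompactPencil V H)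
    {c : ℝ} (hc : c < 0) (n : ℕ) : 0 < P.theta n c := by
  rw [theta, q_apply]
  have h1 := P.d_nonneg (P.eig c n)
  have h2 := mul_pos (neg_pos.2 hc) (P.b_pos (P.eig_ne_zero c n))
  linarith

/-! ### Classes of functions on the line, and regularity of weak solutions. -/

namespace UnitL2

/-- The class of the restriction to the unit interval of a continuous function on the line. -/
noncomputable def ofFun (f : ℝ → ℝ) (hf : Continuous f) : UnitL2 :=
  cls ⟨fun x : I => f x, hf.comp continuous_subtype_val⟩

lemma inner_ofFun {f g : ℝ → ℝ} (hf : Continuous f) (hg : Continuous g) :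
    inner ℝ (ofFun f hf) (ofFun g hg) = ∫ x in (0 : ℝ)..1, f x * g x := by
  rw [ofFun, ofFun, inner_cls]
  refine intervalIntegral.integral_congr fun x hx => ?_
  rw [uIcc_of_le zero_le_one] at hx
  have h1 := ext_coe ⟨fun x : I => f x, hf.comp continuous_subtype_val⟩ ⟨x, hx⟩
  have h2 := ext_coe ⟨fun x : I => g x, hg.comp continuous_subtype_val⟩ ⟨x, hx⟩
  simp only [ContinuousMap.coe_mk] at h1 h2
  simp only [h1, h2]

lemma inner_one_ofFun {f : ℝ → ℝ} (hf : Continuous f) :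
    inner ℝ one (ofFun f hf) = ∫ x in (0 : ℝ)..1, f x := by
  have : one = ofFun (fun _ => 1) continuous_const := rfl
  rw [this, inner_ofFun]
  simp

lemma sum_smul_ofFun {ι : Type*} [Fintype ι] (g : ι → ℝ) (f : ι → ℝ → ℝ)
    (hf : ∀ i, Continuous (f i)) :
    ∑ i, g i • ofFun (f i) (hf i) =
      ofFun (fun x => ∑ i, g i * f i x) (continuous_finsetSum _ fun i _ =>
        continuous_const.mul (hf i)) := by
  simp only [ofFun, ← map_smul, ← map_sum]
  congr 1
  ext x
  simp

lemma ofFun_eq_zero {f : ℝ → ℝ} (hf : Continuous f) :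
    ofFun f hf = 0 ↔ ∀ x ∈ Icc (0 : ℝ) 1, f x = 0 := by
  constructor
  · intro h x hx
    have : (⟨fun x : I => f x, hf.comp continuous_subtype_val⟩ : C(I, ℝ)) = 0 :=
      cls_injective (by rw [map_zero]; exact h)
    exact DFunLike.congr_fun this ⟨x, hx⟩
  · intro h
    have : (⟨fun x : I => f x, hf.comp continuous_subtype_val⟩ : C(I, ℝ)) = 0 := by
      ext x; exact h x x.2
    rw [ofFun, this, map_zero]

lemma volterra_ofFun {f g : ℝ → ℝ} (hf : Continuous f) (hg : Continuous g)
    (hd : ∀ x, HasDerivAt f (g x) x) : volterra (ofFun g hg) = ofFun f hf - f 0 • one := by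
  rw [volterra_apply, ofFun, ofFun, one, ← map_smul, ← map_sub]
  congr 1
  ext x
  have h : ∫ t in (0 : ℝ)..x, ext ⟨fun x : I => g x, hg.comp continuous_subtype_val⟩ t =
      ∫ t in (0 : ℝ)..x, g t := by
    refine intervalIntegral.integral_congr fun t ht => ?_
    rw [uIcc_of_le x.2.1] at ht
    exact ext_coe _ (⟨t, ht.1, ht.2.trans x.2.2⟩ : I)
  rw [prim_cls, h, intervalIntegral.integral_eq_sub_of_hasDerivAt (fun t _ => hd t)
    (hg.intervalIntegrable _ _)]
  simp

/-- Regularity: the integrated form of the rod equation has classical solutions. -/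
lemma exists_rodSolution {y w u : UnitL2} {θ c γ β : ℝ}
    (h1 : y = θ • volterraAdj w + c • volterraAdj (volterraAdj u))
    (h2 : w = γ • one + volterra y) (h3 : u = β • one + volterra w) :
    ∃ X : ℝ → Fin 4 → ℝ, IsRodSolution (-θ) c X ∧ X 1 2 = 0 ∧ X 1 3 = -θ * X 1 1 ∧
      X 0 0 = β ∧ X 0 1 = γ ∧ X 0 2 = θ * inner ℝ one w + c * inner ℝ one (volterraAdj u) ∧
      X 0 3 = -θ * γ - c * inner ℝ one u ∧
      ∃ f : C(I, ℝ), u = cls f ∧ ∀ x, X x 0 = ext f x := by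
  -- The adjoint integrates from `x` to `1`. Hence each class has a continuous representative, `f0`,
  -- …, `f3` being successive derivatives, and the two end conditions are automatic because these
  -- integrals vanish at `1`.
  set v := volterraAdj u with hv
  set g : C(I, ℝ) := (inner ℝ one u : ℝ) • 1 - prim u with hg
  set f0 : C(I, ℝ) := β • 1 + prim w with hf0
  set f1 : C(I, ℝ) := γ • 1 + prim y with hf1
  set f2 : C(I, ℝ) := θ • ((inner ℝ one w : ℝ) • 1 - prim w) +
    c • ((inner ℝ one v : ℝ) • 1 - prim v) with hf2
  set f3 : C(I, ℝ) := (-θ) • f1 - c • g with hf3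
  have ev : v = cls g := by
    rw [hv, volterraAdj_apply, hg, map_sub, map_smul]; rfl
  have eu : u = cls f0 := by rw [h3, hf0, map_add, map_smul]; rfl
  have ew : w = cls f1 := by rw [h2, hf1, map_add, map_smul]; rfl
  have ey : y = cls f2 := by
    rw [h1, hf2, map_add, map_smul, map_smul, map_sub, map_sub, map_smul, map_smul]; rfl
  have x0 : ext f0 = fun x => β + ext (prim w) x := by
    ext x; simp [ext, hf0, IccExtend, Function.comp_apply]
  have x1 : ext f1 = fun x => γ + ext (prim y) x := by
    ext x; simp [ext, hf1, IccExtend, Function.comp_apply]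
  have x2 : ext f2 = fun x => θ * (inner ℝ one w - ext (prim w) x) +
      c * (inner ℝ one v - ext (prim v) x) := by
    ext x; simp [ext, hf2, IccExtend, Function.comp_apply]
  have xg : ext g = fun x => inner ℝ one u - ext (prim u) x := by
    ext x; simp [ext, hg, IccExtend, Function.comp_apply]
  have x3 : ext f3 = fun x => -θ * ext f1 x - c * ext g x := by
    ext x; simp [ext, hf3, IccExtend, Function.comp_apply]
  have p0 : ∀ z, ext (prim z) 0 = 0 := fun z => (ext_coe (prim z) 0).trans (prim_zero z)
  have p1 : ∀ z, ext (prim z) 1 = inner ℝ one z := fun z =>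
    (ext_coe (prim z) 1).trans (prim_one z)
  have du : ∀ x ∈ Icc (0 : ℝ) 1, HasDerivWithinAt (ext (prim u)) (ext f0 x) (Icc 0 1) x := by
    rw [eu]; exact fun x hx => hasDerivWithinAt_prim f0 hx
  have dw : ∀ x ∈ Icc (0 : ℝ) 1, HasDerivWithinAt (ext (prim w)) (ext f1 x) (Icc 0 1) x := by
    conv in prim w => rw [ew]
    exact fun x hx => hasDerivWithinAt_prim f1 hx
  have dy : ∀ x ∈ Icc (0 : ℝ) 1, HasDerivWithinAt (ext (prim y)) (ext f2 x) (Icc 0 1) x := by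
    conv in prim y => rw [ey]
    exact fun x hx => hasDerivWithinAt_prim f2 hx
  have dv : ∀ x ∈ Icc (0 : ℝ) 1, HasDerivWithinAt (ext (prim v)) (ext g x) (Icc 0 1) x := by
    rw [ev]; exact fun x hx => hasDerivWithinAt_prim g hx
  have e0 : ∀ x ∈ Icc (0 : ℝ) 1, HasDerivWithinAt (ext f0) (ext f1 x) (Icc 0 1) x := by
    rw [x0]; exact fun x hx => (dw x hx).const_add β
  have e1 : ∀ x ∈ Icc (0 : ℝ) 1, HasDerivWithinAt (ext f1) (ext f2 x) (Icc 0 1) x := by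
    rw [x1]; exact fun x hx => (dy x hx).const_add γ
  have e2 : ∀ x ∈ Icc (0 : ℝ) 1, HasDerivWithinAt (ext f2) (ext f3 x) (Icc 0 1) x := by
    intro x hx
    rw [x2, x3]
    refine ((((dw x hx).const_sub (inner ℝ one w)).const_mul θ).add
      (((dv x hx).const_sub (inner ℝ one v)).const_mul c)).congr_deriv ?_
    ring
  have e3 : ∀ x ∈ Icc (0 : ℝ) 1,
      HasDerivWithinAt (ext f3) (-θ * ext f2 x + c * ext f0 x) (Icc 0 1) x := by
    intro x hx
    rw [x3, xg]
    refine (((e1 x hx).const_mul (-θ)).sub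
      (((du x hx).const_sub (inner ℝ one u)).const_mul c)).congr_deriv ?_
    ring
  refine ⟨fun x => ![ext f0 x, ext f1 x, ext f2 x, ext f3 x], fun x hx => ?_, ?_, ?_, ?_, ?_, ?_,
    ?_, f0, eu, fun x => rfl⟩
  · refine hasDerivWithinAt_pi.2 fun i => ?_
    fin_cases i
    · exact e0 x hx
    · exact e1 x hx
    · exact e2 x hx
    · exact e3 x hx
  · change ext f2 1 = 0
    simp only [x2, p1]; ring
  · change ext f3 1 = -θ * ext f1 1
    simp only [x3, xg, p1]; ring
  · change ext f0 0 = β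
    simp only [x0, p0, add_zero]
  · change ext f1 0 = γ
    simp only [x1, p0, add_zero]
  · change ext f2 0 = _
    simp only [x2, p0, sub_zero]
  · change ext f3 0 = _
    simp only [x3, xg, x1, p0, sub_zero, add_zero]

end UnitL2

open UnitL2

/-! ### The rod eigenvalue branches as inverse functions of `c ↦ -θ_l(c)`. -/

/-- A Hilbert space formulation of the rod problem for the modes with property `Pr`, the operators
`D`, `J`, `S J` standing for `u''`, `u'`, `u`. -/
structure RodModel (Pr : (ℝ → ℝ) → Prop) (V : Type*) [NormedAddCommGroup V] [NormedSpace ℝ V]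
    extends CompactPencil V UnitL2 where
  sign : ℝ
  sign_eq : sign = 1 ∨ sign = -1
  parity : ∀ {u}, Pr u → ∀ x ∈ Icc (-1 : ℝ) 1, u (-x) = sign * u x
  -- Weak solutions are classical; the next field is the converse, and the last is simplicity in the
  -- class.
  exists_mode : ∀ {θ c : ℝ} {x : V}, x ≠ 0 →
    (∀ z, toCompactPencil.q c x z = θ * toCompactPencil.a x z) →
    ∃ u, IsFreeRodEigenfunction (-θ) c u ∧ Pr u ∧ ∃ hu : Continuous u, S (J x) = ofFun u hu
  exists_vec : ∀ {τ μ : ℝ} {u : ℝ → ℝ}, IsFreeRodEigenfunction τ μ u → Pr u →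
    ∃ (x : V) (h0 : Continuous u) (h1 : Continuous (iteratedDeriv 1 u))
      (h2 : Continuous (iteratedDeriv 2 u)),
      D x = ofFun _ h2 ∧ J x = ofFun _ h1 ∧ S (J x) = ofFun _ h0
  exists_rel : ∀ {τ μ : ℝ} {u v : ℝ → ℝ}, IsFreeRodEigenfunction τ μ u → Pr u →
    IsFreeRodEigenfunction τ μ v → Pr v → ∃ α β : ℝ, (α ≠ 0 ∨ β ≠ 0) ∧
      ∀ x ∈ Icc (0 : ℝ) 1, α * u x + β * v x = 0

namespace RodModel

variable {Pr : (ℝ → ℝ) → Prop} {V : Type*} [NormedAddCommGroup V] [NormedSpace ℝ V]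
  (M : RodModel Pr V)

/-- The form identity for the vectors of two modes. -/
lemma form_eq {τ μ ν : ℝ} {u v : ℝ → ℝ} (hu : IsFreeRodEigenfunction τ μ u) (hPu : Pr u)
    (hv : IsFreeRodEigenfunction τ ν v) (hPv : Pr v) {x y : V}
    {h0 : Continuous u} {h1 : Continuous (iteratedDeriv 1 u)} {h2 : Continuous (iteratedDeriv 2 u)}
    {k0 : Continuous v} {k1 : Continuous (iteratedDeriv 1 v)} {k2 : Continuous (iteratedDeriv 2 v)}
    (hx : M.D x = ofFun _ h2 ∧ M.J x = ofFun _ h1 ∧ M.S (M.J x) = ofFun _ h0)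
    (hy : M.D y = ofFun _ k2 ∧ M.J y = ofFun _ k1 ∧ M.S (M.J y) = ofFun _ k0) :
    M.d x y + τ * M.a x y = μ * M.b x y := by
  rw [M.d_apply, M.a_apply, M.b_apply, hx.2.2, hy.2.2, hx.1, hy.1, hx.2.1, hy.2.1, inner_ofFun,
    inner_ofFun, inner_ofFun]
  have := (hu.isHalfMode (M.parity hPu)).green M.sign_eq (hv.isHalfMode (M.parity hPv))
  simpa using this

variable [CompleteSpace V]

/-- Equality would give two `a`-orthonormal eigenvectors with the same `θ` and `c`, hence two modes
of one rod problem, which simplicity makes proportional. -/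
lemma theta_lt_succ (l : ℕ) (c : ℝ) : M.theta l c < M.theta (l + 1) c := by
  refine (M.theta_mono c l.le_succ).lt_of_ne fun heq => ?_
  obtain ⟨u, hu, hPu, cu, eu⟩ := M.exists_mode (M.eig_ne_zero c l) (M.q_eig c l)
  obtain ⟨v, hv, hPv, cv, ev⟩ := M.exists_mode (M.eig_ne_zero c (l + 1)) (M.q_eig c (l + 1))
  rw [← heq] at hv
  obtain ⟨α, β, h0, h⟩ := M.exists_rel hu hPu hv hPv
  have h1 : α • M.eig c l + β • M.eig c (l + 1) = 0 := by
    refine M.injective_J (M.injective_S ?_)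
    simp only [map_add, map_smul, map_zero, eu, ev]
    have := sum_smul_ofFun ![α, β] ![u, v] (by intro i; fin_cases i <;> assumption)
    simp only [Fin.sum_univ_two] at this
    refine this.trans ((ofFun_eq_zero _).2 fun x hx => ?_)
    simpa using h x hx
  have h2 := congrArg (M.a (M.eig c l)) h1
  have h3 := congrArg (M.a (M.eig c (l + 1))) h1
  simp only [map_add, map_smul, map_zero, M.a_eig_self, M.a_eig_of_ne c (Nat.succ_ne_self l),
    M.a_eig_of_ne c (Nat.succ_ne_self l).symm, smul_eq_mul, mul_one, mul_zero, add_zero,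
    zero_add] at h2 h3
  exact h0.elim (fun h => h h2) (fun h => h h3)

lemma strictMono_theta (c : ℝ) : StrictMono fun l => M.theta l c :=
  strictMono_nat_of_lt_succ fun l => M.theta_lt_succ l c

/-- For each `i ≤ l` solve `θ_i(ν_i) = -τ`. Since `θ_i` increases strictly in `i` and decreases in
`c`, the `ν_i` increase strictly up to `ν_l = c`; distinct eigenvalues make the modes
`b`-orthogonal. -/
lemma mem_of_theta_eq {l : ℕ} {c τ : ℝ} (h : M.theta l c = -τ) :
    ∃ (u : Fin (l + 1) → ℝ → ℝ) (ν : Fin (l + 1) → ℝ),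
      (∀ i, ν i ≤ c ∧ IsFreeRodEigenfunction τ (ν i) (u i) ∧ Pr (u i)) ∧
      LinearIndependent ℝ (fun i (x : Icc (-1 : ℝ) 1) => u i x) := by
  choose ν hν using fun i => M.surjective_theta i (-τ)
  have hνm : StrictMono ν := by
    intro i j hij
    rw [← (M.strictAnti_theta j).lt_iff_gt, hν j, ← hν i]
    exact M.strictMono_theta _ hij
  have hνl : ν l = c := (M.strictAnti_theta l).injective ((hν l).trans h.symm)
  have hq : ∀ i z, M.q (ν i) (M.eig (ν i) i) z = -τ * M.a (M.eig (ν i) i) z := fun i z => by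
    rw [M.q_eig, hν]
  choose u hu hPu cu eu using fun i => M.exists_mode (M.eig_ne_zero (ν i) i) (hq i)
  have hb : ∀ i j, i ≠ j → M.b (M.eig (ν i) i) (M.eig (ν j) j) = 0 := by
    intro i j hij
    have h1 := hq i (M.eig (ν j) j)
    have h2 := hq j (M.eig (ν i) i)
    rw [M.q_apply, M.d_comm, M.b_comm, M.a_comm] at h2
    rw [M.q_apply] at h1
    have h3 : (ν i - ν j) * M.b (M.eig (ν i) i) (M.eig (ν j) j) = 0 := by linarith
    exact (mul_eq_zero.1 h3).resolve_left (sub_ne_zero.2 (hνm.injective.ne hij))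
  refine ⟨fun i => u i, fun i => ν i, fun i => ⟨?_, ?_, hPu i⟩, ?_⟩
  · rw [← hνl]; exact hνm.monotone (Nat.lt_succ_iff.1 i.2)
  · simpa using hu i
  · refine Fintype.linearIndependent_iff.2 fun g hg j => ?_
    have h1 : ∑ i : Fin (l + 1), g i • M.S (M.J (M.eig (ν i) i)) = 0 := by
      simp only [eu]
      rw [sum_smul_ofFun g (fun i => u i) (fun i => cu i), ofFun_eq_zero]
      intro x hx
      simpa using congrFun hg ⟨x, by linarith [hx.1], hx.2⟩
    have h2 := congrArg (fun z => inner ℝ (M.S (M.J (M.eig (ν j) j))) z) h1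
    simp only [inner_sum, inner_smul_right, inner_zero_right] at h2
    rw [Finset.sum_eq_single j] at h2
    · rw [← M.b_apply] at h2
      exact (mul_eq_zero.1 h2).resolve_right (M.b_pos (M.eig_ne_zero _ _)).ne'
    · intro i _ hij
      rw [← M.b_apply, hb _ _ (fun h => hij (Fin.ext h.symm)), mul_zero]
    · simp

/-- On the span of the modes `d + τ a ≤ c b`, that is `q ≤ -τ a`, so the span is a trial space for
min-max. -/
lemma theta_le_of_modes {l : ℕ} {c τ : ℝ} {u : Fin (l + 1) → ℝ → ℝ} {ν : Fin (l + 1) → ℝ}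
    (h : ∀ i, ν i ≤ c ∧ IsFreeRodEigenfunction τ (ν i) (u i) ∧ Pr (u i))
    (hli : LinearIndependent ℝ (fun i (x : Icc (-1 : ℝ) 1) => u i x)) : M.theta l c ≤ -τ := by
  have sgn : M.sign * M.sign = 1 := by rcases M.sign_eq with h | h <;> rw [h] <;> norm_num
  -- Independence is assumed on `[-1, 1]`, but by parity a relation on `[0, 1]` holds on all of it.
  have hzero : ∀ g : Fin (l + 1) → ℝ, (∀ x ∈ Icc (0 : ℝ) 1, ∑ i, g i * u i x = 0) → g = 0 := by
    intro g hg
    refine funext (Fintype.linearIndependent_iff.1 hli g ?_)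
    ext ⟨x, hx⟩
    simp only [Finset.sum_apply, Pi.smul_apply, smul_eq_mul, Pi.zero_apply]
    rcases le_total 0 x with h0 | h0
    · exact hg x ⟨h0, hx.2⟩
    · have h1 := hg (-x) ⟨by linarith, by linarith [hx.1]⟩
      simp only [M.parity (h _).2.2 x hx] at h1
      have h2 : M.sign * ∑ i, g i * u i x = 0 := by
        rw [Finset.mul_sum, ← h1]; exact Finset.sum_congr rfl fun i _ => by ring
      linear_combination M.sign * h2 - (∑ i, g i * u i x) * sgn
  -- Simplicity makes the eigenvalues of independent modes distinct, so `b` is diagonal on their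
  -- span.
  have hinj : Function.Injective ν := by
    intro i j hij
    by_contra hne
    have hj := (h j).2.1
    rw [← hij] at hj
    obtain ⟨α, β, h0, hrel⟩ := M.exists_rel (h i).2.1 (h i).2.2 hj (h j).2.2
    have hg := hzero (Pi.single i α + Pi.single j β) (fun x hx => by
      simp only [Pi.add_apply, add_mul, Finset.sum_add_distrib, Pi.single_apply, ite_mul, zero_mul,
        Finset.sum_ite_eq', Finset.mem_univ, if_true]
      exact hrel x hx)
    have g1 := congrFun hg i
    have g2 := congrFun hg j
    simp [hne, Ne.symm hne] at g1 g2
    simp [g1, g2] at h0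
  choose x h0 h1 h2 hx using fun i => M.exists_vec (h i).2.1 (h i).2.2
  have hform : ∀ i j, M.d (x i) (x j) + τ * M.a (x i) (x j) = ν i * M.b (x i) (x j) := fun i j =>
    M.form_eq (h i).2.1 (h i).2.2 (h j).2.1 (h j).2.2 (hx i) (hx j)
  have hb : ∀ i j, i ≠ j → M.b (x i) (x j) = 0 := by
    intro i j hij
    have e1 := hform i j
    have e2 := hform j i
    rw [M.d_comm, M.a_comm, M.b_comm] at e2
    have e3 : (ν i - ν j) * M.b (x i) (x j) = 0 := by linarith
    exact (mul_eq_zero.1 e3).resolve_left (sub_ne_zero.2 (hinj.ne hij))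
  have hxli : LinearIndependent ℝ x := by
    refine Fintype.linearIndependent_iff.2 fun g hg => congrFun (hzero g ?_)
    have e := congrArg (fun z => M.S (M.J z)) hg
    simp only [map_sum, map_smul, map_zero, (hx _).2.2] at e
    rw [sum_smul_ofFun] at e
    exact (ofFun_eq_zero _).1 e
  refine M.theta_le_of_linearIndependent hxli fun s => ?_
  set z := ∑ i, s i • x i with hz
  have hbj : ∀ i, M.b (x i) z = s i * M.b (x i) (x i) := by
    intro i
    rw [hz, map_sum, Finset.sum_eq_single i]
    · rw [map_smul, smul_eq_mul]
    · intro j _ hj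
      rw [map_smul, hb i j hj.symm, smul_zero]
    · simp
  have hfz : ∀ i, M.d (x i) z + τ * M.a (x i) z = ν i * M.b (x i) z := by
    intro i
    simp only [hz, map_sum, map_smul, smul_eq_mul, Finset.mul_sum, ← Finset.sum_add_distrib]
    exact Finset.sum_congr rfl fun j _ => by linear_combination s j * hform i j
  have key : M.d z z + τ * M.a z z = ∑ i, ν i * (s i ^ 2 * M.b (x i) (x i)) := by
    have e : ∀ B : V →ₗ[ℝ] V →ₗ[ℝ] ℝ, B z z = ∑ i, s i * B (x i) z := fun B => by
      conv_lhs => enter [1]; rw [hz]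
      simp
    rw [e M.d, e M.a, Finset.mul_sum, ← Finset.sum_add_distrib]
    exact Finset.sum_congr rfl fun i _ => by
      linear_combination s i * hfz i + s i * ν i * hbj i
  have key2 : M.b z z = ∑ i, s i ^ 2 * M.b (x i) (x i) := by
    have e : M.b z z = ∑ i, s i * M.b (x i) z := by
      conv_lhs => enter [1]; rw [hz]
      simp
    rw [e]
    exact Finset.sum_congr rfl fun i _ => by rw [hbj]; ring
  have hle : M.d z z + τ * M.a z z ≤ c * M.b z z := by
    rw [key, key2, Finset.mul_sum]
    refine Finset.sum_le_sum fun i _ => mul_le_mul_of_nonneg_right (h i).1 ?_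
    exact mul_nonneg (sq_nonneg _) (M.b_nonneg _)
  rw [M.q_apply]
  linarith

theorem rodEigenvalue_eq {l : ℕ} {c τ : ℝ} (h : M.theta l c = -τ) : rodEigenvalue Pr l τ = c := by
  refine IsLeast.csInf_eq ⟨M.mem_of_theta_eq h, ?_⟩
  rintro c' ⟨u, ν, h1, h2⟩
  have := M.theta_le_of_modes h1 h2
  rw [← h] at this
  exact (M.strictAnti_theta l).le_iff_ge.1 this

end RodModel

/-! ### The two concrete models: even modes of mean zero, and odd modes. -/

namespace UnitL2

lemma eq_zero_of_volterra_eq_smul_one {y : UnitL2} {r : ℝ} (h : volterra y = r • one) :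
    y = 0 ∧ r = 0 := by
  have h1 : prim y = r • 1 := cls_injective (by rw [map_smul]; exact h)
  have h2 : r = 0 := by
    have := DFunLike.congr_fun h1 0
    rw [prim_zero] at this
    simpa using this.symm
  refine ⟨volterra_injective ?_, h2⟩
  rw [h, h2, zero_smul, map_zero]

/-- The primitive of mean zero. -/
noncomputable def meanZeroPrim : UnitL2 →L[ℝ] UnitL2 :=
  volterra - ((innerSL ℝ one) ∘L volterra).smulRight one

lemma meanZeroPrim_apply (w : UnitL2) :
    meanZeroPrim w = volterra w - (inner ℝ one (volterra w) : ℝ) • one := rfl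

lemma inner_one_meanZeroPrim (w : UnitL2) : inner ℝ one (meanZeroPrim w) = (0 : ℝ) := by
  rw [meanZeroPrim_apply, inner_sub_right, inner_smul_right, inner_one_one, mul_one, sub_self]

lemma meanZeroPrim_injective : Function.Injective meanZeroPrim :=
  (injective_iff_map_eq_zero _).2 fun w hw => by
    rw [meanZeroPrim_apply, sub_eq_zero] at hw
    exact (eq_zero_of_volterra_eq_smul_one hw).1

/-- The derivative of an odd function in terms of its value at `0` and its derivative. -/
noncomputable def affinePrim : (ℝ × UnitL2) →L[ℝ] UnitL2 :=
  (ContinuousLinearMap.toSpanSingleton ℝ one) ∘L (ContinuousLinearMap.fst ℝ ℝ UnitL2) +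
    volterra ∘L (ContinuousLinearMap.snd ℝ ℝ UnitL2)

lemma affinePrim_apply (x : ℝ × UnitL2) : affinePrim x = x.1 • one + volterra x.2 := rfl

lemma affinePrim_injective : Function.Injective affinePrim :=
  (injective_iff_map_eq_zero _).2 fun x hx => by
    rw [affinePrim_apply, add_comm, add_eq_zero_iff_eq_neg, ← neg_smul] at hx
    obtain ⟨h1, h2⟩ := eq_zero_of_volterra_eq_smul_one hx
    exact Prod.ext (neg_eq_zero.1 h2) h1

lemma isCompact_affinePrim : IsCompactOperator affinePrim := by
  refine IsCompactOperator.add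
    (f := (ContinuousLinearMap.toSpanSingleton ℝ one) ∘L (ContinuousLinearMap.fst ℝ ℝ UnitL2))
    (g := volterra ∘L (ContinuousLinearMap.snd ℝ ℝ UnitL2)) ?_ ?_
  · have : IsCompactOperator (ContinuousLinearMap.toSpanSingleton ℝ one) := by
      refine (isCompactOperator_iff_isCompact_closure_image_closedBall
        (ContinuousLinearMap.toSpanSingleton ℝ one : ℝ →ₗ[ℝ] UnitL2) one_pos).2 ?_
      exact ((isCompact_closedBall (0 : ℝ) 1).image
        (ContinuousLinearMap.toSpanSingleton ℝ one).continuous).closure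
    exact this.comp_clm (ContinuousLinearMap.fst ℝ ℝ UnitL2)
  · exact isCompact_volterra.comp_clm (ContinuousLinearMap.snd ℝ ℝ UnitL2)

lemma norm_one_eq : ‖one‖ = 1 := by
  have := real_inner_self_eq_norm_sq one
  rw [inner_one_one] at this
  nlinarith [norm_nonneg one]

/-- The `L²` norm of `u''` does not see `u'(0)`; this value is recovered from `u'` by subtracting
the primitive of `u''`. -/
lemma affinePrim_coercive (x : ℝ × UnitL2) :
    ‖x‖ ^ 2 ≤ (3 + 2 * ‖volterra‖ ^ 2) * (‖x.2‖ ^ 2 + ‖affinePrim x‖ ^ 2) := by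
  have h1 : |x.1| ≤ ‖affinePrim x‖ + ‖volterra‖ * ‖x.2‖ := by
    calc |x.1| = ‖x.1 • one‖ := by rw [norm_smul, norm_one_eq, mul_one, Real.norm_eq_abs]
      _ = ‖affinePrim x - volterra x.2‖ := by rw [affinePrim_apply, add_sub_cancel_right]
      _ ≤ ‖affinePrim x‖ + ‖volterra x.2‖ := norm_sub_le _ _
      _ ≤ _ := by gcongr; exact volterra.le_opNorm _
  have h2 : ‖x‖ ^ 2 ≤ |x.1| ^ 2 + ‖x.2‖ ^ 2 := by
    rw [Prod.norm_def, Real.norm_eq_abs]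
    rcases max_cases |x.1| ‖x.2‖ with ⟨h, -⟩ | ⟨h, -⟩ <;> rw [h]
    · nlinarith [sq_nonneg ‖x.2‖]
    · nlinarith [sq_nonneg |x.1|]
  have h3 : |x.1| ^ 2 ≤ 2 * ‖affinePrim x‖ ^ 2 + 2 * (‖volterra‖ * ‖x.2‖) ^ 2 := by
    have := pow_le_pow_left₀ (abs_nonneg _) h1 2
    nlinarith [sq_nonneg (‖affinePrim x‖ - ‖volterra‖ * ‖x.2‖)]
  have h4 : 0 ≤ (‖volterra‖ * ‖affinePrim x‖) ^ 2 := sq_nonneg _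
  nlinarith [sq_nonneg ‖x.2‖, sq_nonneg ‖affinePrim x‖]

end UnitL2

lemma integral_neg_one_one_of_even {u : ℝ → ℝ} (hc : Continuous u)
    (h : ∀ x ∈ Icc (-1 : ℝ) 1, u (-x) = u x) :
    ∫ x in (-1 : ℝ)..1, u x = 2 * ∫ x in (0 : ℝ)..1, u x := by
  have h1 := intervalIntegral.integral_comp_neg u (a := 0) (b := 1)
  have h2 : ∫ x in (0 : ℝ)..1, u (-x) = ∫ x in (0 : ℝ)..1, u x := by
    refine intervalIntegral.integral_congr fun x hx => ?_
    rw [uIcc_of_le zero_le_one] at hx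
    exact h x ⟨by linarith [hx.1], hx.2⟩
  rw [← intervalIntegral.integral_add_adjacent_intervals (b := 0) (hc.intervalIntegrable _ _)
    (hc.intervalIntegrable _ _)]
  rw [h2, neg_zero] at h1
  rw [← h1]; ring

lemma IsFreeRodEigenfunction.volterra_deriv {τ μ : ℝ} {u : ℝ → ℝ}
    (hu : IsFreeRodEigenfunction τ μ u) (k : ℕ) (hk : k < 4)
    (h0 : Continuous (iteratedDeriv k u)) (h1 : Continuous (iteratedDeriv (k + 1) u)) :
    volterra (ofFun _ h1) = ofFun _ h0 - iteratedDeriv k u 0 • one :=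
  volterra_ofFun h0 h1 fun x => by
    rw [iteratedDeriv_succ]
    exact ((hu.1.differentiable_iteratedDeriv k (by exact_mod_cast hk)) x).hasDerivAt

lemma IsHalfMode.exists_mode_of_cls {s τ μ : ℝ} {X : ℝ → Fin 4 → ℝ} (hs : s * s = 1)
    (hX : IsHalfMode s τ μ X) {f : C(I, ℝ)} (hf : cls f ≠ 0) (hXf : ∀ x, X x 0 = ext f x) :
    ∃ u : ℝ → ℝ, IsFreeRodEigenfunction τ μ u ∧ (∀ x, u (-x) = s * u x) ∧
      ∃ hu : Continuous u, cls f = ofFun u hu := by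
  have hne : ∃ x ∈ Icc (0 : ℝ) 1, X x 0 ≠ 0 := by
    by_contra! h
    refine hf ?_
    have : f = 0 := by
      ext x; rw [← ext_coe, ← hXf]; exact h x x.2
    rw [this, map_zero]
  obtain ⟨u, h1, h2, h3⟩ := hX.isFreeRodEigenfunction hs hne
  refine ⟨u, h1, h2, h1.1.continuous, ?_⟩
  rw [ofFun]
  congr 1
  ext x
  rw [← ext_coe, ← hXf]
  exact (h3 x x.2).symm

/-- Even modes of mean zero: `u''` ranges over `L²`. -/
noncomputable def evenModel : RodModel IsEvenMode UnitL2 where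
  D := ContinuousLinearMap.id ℝ UnitL2
  J := volterra
  S := meanZeroPrim
  injective_J := volterra_injective
  injective_S := meanZeroPrim_injective
  isCompact_J := isCompact_volterra
  coercive := ⟨1, zero_le_one, fun x => by
    rw [one_mul, ContinuousLinearMap.id_apply]
    exact le_add_of_nonneg_right (sq_nonneg _)⟩
  infinite := not_finiteDimensional
  sign := 1
  sign_eq := Or.inl rfl
  parity := fun h x hx => by rw [one_mul]; exact h.1 x hx
  exists_mode := by
    intro θ c y hy hq
    set w := volterra y with hw
    set u := meanZeroPrim w with hu
    have hu1 : inner ℝ one u = (0 : ℝ) := inner_one_meanZeroPrim w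
    have h1 : y = θ • volterraAdj w + c • volterraAdj (volterraAdj u) := by
      refine ext_inner_right ℝ fun z => ?_
      have h : inner ℝ y z - c * inner ℝ u (meanZeroPrim (volterra z)) =
        θ * inner ℝ w (volterra z) := hq z
      -- As `u` has mean zero, the constant subtracted in the test function drops out, so the
      -- natural conditions are those of the unconstrained problem.
      rw [meanZeroPrim_apply, inner_sub_right, inner_smul_right, real_inner_comm one u, hu1,
        mul_zero, sub_zero] at h
      rw [inner_add_left, inner_smul_left, inner_smul_left, inner_volterraAdj, inner_volterraAdj,
        inner_volterraAdj]
      simp only [conj_trivial]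
      linarith
    have h2 : w = (0 : ℝ) • one + volterra y := by rw [zero_smul, zero_add]
    have h3 : u = (-(inner ℝ one (volterra w) : ℝ)) • one + volterra w := by
      rw [hu, meanZeroPrim_apply, neg_smul]; abel
    obtain ⟨X, hX, e2, e3, s0, s1, s2, s3, f, hf, hXf⟩ := exists_rodSolution h1 h2 h3
    have hmode : IsHalfMode 1 (-θ) c X :=
      ⟨hX, e2, e3, one_mul _, by rw [s1, mul_zero], one_mul _, by rw [s3, hu1]; ring⟩
    have hne : u ≠ 0 := fun h => hy (volterra_injective (meanZeroPrim_injective (by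
      rw [map_zero, map_zero]; exact h)))
    obtain ⟨v, v1, v2, v3, v4⟩ := hmode.exists_mode_of_cls (by norm_num) (hf ▸ hne) hXf
    have v2' : ∀ x ∈ Icc (-1 : ℝ) 1, v (-x) = v x := fun x _ => by rw [v2, one_mul]
    refine ⟨v, v1, ⟨v2', ?_⟩, v3, hf.trans v4⟩
    rw [integral_neg_one_one_of_even v3 v2', ← inner_one_ofFun v3, ← v4, ← hf, hu1, mul_zero]
  exists_vec := by
    intro τ μ u hu hP
    have hc : ∀ k : ℕ, k ≤ 4 → Continuous (iteratedDeriv k u) := fun k hk =>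
      hu.1.continuous_iteratedDeriv k (by exact_mod_cast hk)
    have c0 := hu.1.continuous
    have c1 := hc 1 (by norm_num)
    have c2 := hc 2 (by norm_num)
    have hmode := hu.isHalfMode (s := 1) (fun x hx => by rw [one_mul]; exact hP.1 x hx)
    have z1 : iteratedDeriv 1 u 0 = 0 := by
      have : -1 * iteratedDeriv 1 u 0 = iteratedDeriv 1 u 0 := hmode.start_one
      linarith
    have v1 : volterra (ofFun _ c2) = ofFun _ c1 := by
      rw [hu.volterra_deriv 1 (by norm_num) c1 c2, z1, zero_smul, sub_zero]
    have v0 : volterra (ofFun _ c1) = ofFun _ c0 - u 0 • one :=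
      hu.volterra_deriv 0 (by norm_num) c0 c1
    have hm : inner ℝ one (ofFun u c0) = (0 : ℝ) := by
      have := hP.2
      rw [integral_neg_one_one_of_even c0 hP.1] at this
      rw [inner_one_ofFun]; linarith
    refine ⟨ofFun _ c2, c0, c1, c2, rfl, v1, ?_⟩
    rw [v1, meanZeroPrim_apply, v0, inner_sub_right, inner_smul_right, inner_one_one, hm]
    simp
  exists_rel := by
    intro τ μ u v hu hPu hv hPv
    have h1 := hu.isHalfMode (s := 1) (fun x hx => by rw [one_mul]; exact hPu.1 x hx)
    have h2 := hv.isHalfMode (s := 1) (fun x hx => by rw [one_mul]; exact hPv.1 x hx)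
    have m1 := hPu.2
    have m2 := hPv.2
    rw [integral_neg_one_one_of_even hu.1.continuous hPu.1] at m1
    rw [integral_neg_one_one_of_even hv.1.continuous hPv.1] at m2
    obtain ⟨α, β, h0, h⟩ := h1.exists_rel_even h2 (by simpa using m1) (by simpa using m2)
    exact ⟨α, β, h0, fun x hx => by simpa using congrFun (h hx) 0⟩

/-- Odd modes: the pair `(u' (0), u'')` ranges over `ℝ × L²`. -/
noncomputable def oddModel : RodModel IsOddMode (ℝ × UnitL2) where
  D := ContinuousLinearMap.snd ℝ ℝ UnitL2
  J := affinePrim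
  S := volterra
  injective_J := affinePrim_injective
  injective_S := volterra_injective
  isCompact_J := isCompact_affinePrim
  coercive := ⟨_, by positivity, affinePrim_coercive⟩
  infinite := fun h => not_finiteDimensional
    (FiniteDimensional.of_injective (LinearMap.inr ℝ ℝ UnitL2) LinearMap.inr_injective)
  sign := -1
  sign_eq := Or.inr rfl
  parity := fun h x hx => by rw [neg_one_mul]; exact h x hx
  exists_mode := by
    intro θ c x hx hq
    set w := affinePrim x with hw
    set u := volterra w with hu
    have hq' : ∀ z : ℝ × UnitL2, inner ℝ x.2 z.2 - c * inner ℝ u (volterra (affinePrim z)) =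
      θ * inner ℝ w (affinePrim z) := hq
    have h1 : x.2 = θ • volterraAdj w + c • volterraAdj (volterraAdj u) := by
      refine ext_inner_right ℝ fun z => ?_
      have h := hq' (0, z)
      simp only [affinePrim_apply, zero_smul, zero_add] at h
      rw [inner_add_left, inner_smul_left, inner_smul_left, inner_volterraAdj, inner_volterraAdj,
        inner_volterraAdj]
      simp only [conj_trivial]
      linarith
    -- Testing with `(1, 0)`, the function `v(x) = x`, gives `u''(0) = 0`, the start condition that
    -- parity requires.
    have h4 : θ * inner ℝ one w + c * inner ℝ one (volterraAdj u) = 0 := by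
      have h := hq' (1, 0)
      simp only [affinePrim_apply, one_smul, map_zero, add_zero, inner_zero_right] at h
      rw [real_inner_comm (volterraAdj u) one, inner_volterraAdj, real_inner_comm w one]
      linarith
    have h3 : u = (0 : ℝ) • one + volterra w := by rw [zero_smul, zero_add]
    obtain ⟨X, hX, e2, e3, s0, s1, s2, s3, f, hf, hXf⟩ :=
      exists_rodSolution h1 (affinePrim_apply x) h3
    have hmode : IsHalfMode (-1) (-θ) c X :=
      ⟨hX, e2, e3, by rw [s0, mul_zero], by ring, by rw [s2, h4, mul_zero], by ring⟩
    have hne : u ≠ 0 := fun h => hx (affinePrim_injective (volterra_injective (by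
      rw [map_zero, map_zero]; exact h)))
    obtain ⟨v, v1, v2, v3, v4⟩ := hmode.exists_mode_of_cls (by norm_num) (hf ▸ hne) hXf
    exact ⟨v, v1, fun x _ => by rw [v2, neg_one_mul], v3, hf.trans v4⟩
  exists_vec := by
    intro τ μ u hu hP
    have hc : ∀ k : ℕ, k ≤ 4 → Continuous (iteratedDeriv k u) := fun k hk =>
      hu.1.continuous_iteratedDeriv k (by exact_mod_cast hk)
    have c0 := hu.1.continuous
    have c1 := hc 1 (by norm_num)
    have c2 := hc 2 (by norm_num)
    have z0 : u 0 = 0 := by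
      have := hP 0 (by norm_num)
      rw [neg_zero] at this
      linarith
    have v1 := hu.volterra_deriv 1 (by norm_num) c1 c2
    have v0 : volterra (ofFun _ c1) = ofFun _ c0 - u 0 • one :=
      hu.volterra_deriv 0 (by norm_num) c0 c1
    have v2 : affinePrim (iteratedDeriv 1 u 0, ofFun _ c2) = ofFun _ c1 := by
      rw [affinePrim_apply, v1]; abel
    refine ⟨(iteratedDeriv 1 u 0, ofFun _ c2), c0, c1, c2, rfl, v2, ?_⟩
    rw [v2, v0, z0, zero_smul, sub_zero]
  exists_rel := by
    intro τ μ u v hu hPu hv hPv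
    have h1 := hu.isHalfMode (s := -1) (fun x hx => by rw [neg_one_mul]; exact hPu x hx)
    have h2 := hv.isHalfMode (s := -1) (fun x hx => by rw [neg_one_mul]; exact hPv x hx)
    obtain ⟨α, β, h0, h⟩ := h1.exists_rel_odd h2
    exact ⟨α, β, h0, fun x hx => by simpa using congrFun (h hx) 0⟩

/-! ### Level curves, and the two assertions about the regions. -/

namespace RodModel

variable {Pr : (ℝ → ℝ) → Prop} {V : Type*} [NormedAddCommGroup V] [NormedSpace ℝ V]
  [CompleteSpace V] (M : RodModel Pr V)

lemma theta_rodEigenvalue (l : ℕ) (τ : ℝ) : M.theta l (rodEigenvalue Pr l τ) = -τ := by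
  obtain ⟨c, hc⟩ := M.surjective_theta l (-τ)
  rw [M.rodEigenvalue_eq hc, hc]

lemma rodEigenvalue_lt_iff {l : ℕ} {τ c : ℝ} : rodEigenvalue Pr l τ < c ↔ τ < -M.theta l c := by
  rw [← (M.strictAnti_theta l).lt_iff_gt, M.theta_rodEigenvalue, lt_neg]

lemma lt_rodEigenvalue_iff {l : ℕ} {τ c : ℝ} : c < rodEigenvalue Pr l τ ↔ -M.theta l c < τ := by
  rw [← (M.strictAnti_theta l).lt_iff_gt, M.theta_rodEigenvalue, neg_lt]

/-- The level curve on which the rescaled `l`-th eigenvalue equals `c`. -/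
noncomputable def curve (c : ℝ) (l : ℕ) (R : ℝ) : ℝ := -M.theta l (c * R ^ 4) / R ^ 2

lemma continuousOn_curve (c : ℝ) (l : ℕ) : ContinuousOn (M.curve c l) (Ioi 0) := by
  refine ContinuousOn.div ?_ (by fun_prop) fun R hR => pow_ne_zero _ (ne_of_gt hR)
  exact ((M.continuous_theta l).comp (by fun_prop)).neg.continuousOn

lemma curve_succ_lt (c : ℝ) (l : ℕ) {R : ℝ} (hR : 0 < R) : M.curve c (l + 1) R < M.curve c l R := by
  refine div_lt_div_of_pos_right (neg_lt_neg ?_) (by positivity)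
  exact M.theta_lt_succ l _

lemma curve_lt_curve {c c' : ℝ} (h : c < c') (l : ℕ) {R : ℝ} (hR : 0 < R) :
    M.curve c l R < M.curve c' l R := by
  refine div_lt_div_of_pos_right (neg_lt_neg (M.strictAnti_theta l ?_)) (by positivity)
  exact mul_lt_mul_of_pos_right h (by positivity)

lemma scaled_lt_iff {l : ℕ} {R τ c : ℝ} (hR : 0 < R) :
    (R ^ 4)⁻¹ * rodEigenvalue Pr l (τ * R ^ 2) < c ↔ τ < M.curve c l R := by
  rw [inv_mul_lt_iff₀ (by positivity), mul_comm (R ^ 4), M.rodEigenvalue_lt_iff, curve,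
    lt_div_iff₀ (by positivity)]

lemma lt_scaled_iff {l : ℕ} {R τ c : ℝ} (hR : 0 < R) :
    c < (R ^ 4)⁻¹ * rodEigenvalue Pr l (τ * R ^ 2) ↔ M.curve c l R < τ := by
  rw [lt_inv_mul_iff₀ (by positivity), mul_comm (R ^ 4), M.lt_rodEigenvalue_iff, curve,
    div_lt_iff₀ (by positivity)]

theorem movesDownwards (M : RodModel Pr V) {a b : ℝ} (hab : a < b) :
    MovesDownwards fun l => {q : ℝ × ℝ | 0 < q.1 ∧
      (q.1 ^ 4)⁻¹ * rodEigenvalue Pr l (q.2 * q.1 ^ 2) ∈ Ioo a b} := by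
  refine ⟨M.curve a, M.curve b, fun l => ⟨M.continuousOn_curve a l, M.continuousOn_curve b l,
    fun R hR => M.curve_lt_curve hab l hR, ?_⟩,
    fun l R hR => ⟨M.curve_succ_lt b l hR, M.curve_succ_lt a l hR⟩⟩
  ext q
  exact and_congr_right fun hq => and_congr (M.lt_scaled_iff hq) (M.scaled_lt_iff hq)

theorem ssubset_succ (M : RodModel Pr V) {A : ℝ} (hA : A < 0) (l : ℕ) :
    {q : ℝ × ℝ | 0 < q.1 ∧ (q.1 ^ 4)⁻¹ * rodEigenvalue Pr (l + 1) (q.2 * q.1 ^ 2) < A ∧ q.2 < 0} ⊂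
    {q : ℝ × ℝ | 0 < q.1 ∧ (q.1 ^ 4)⁻¹ * rodEigenvalue Pr l (q.2 * q.1 ^ 2) < A ∧ q.2 < 0} := by
  -- The witness is the boundary point at `R = 1` of the smaller region: the strict inequality
  -- excludes it there, while it lies below the higher curve of the larger one.
  refine (ssubset_iff_of_subset ?_).2 ⟨(1, M.curve A (l + 1) 1), ?_, ?_⟩
  · rintro q ⟨h1, h2, h3⟩
    exact ⟨h1, (M.scaled_lt_iff h1).2 (((M.scaled_lt_iff h1).1 h2).trans (M.curve_succ_lt A l h1)),
      h3⟩
  · refine ⟨one_pos, (M.scaled_lt_iff one_pos).2 (M.curve_succ_lt A l one_pos), ?_⟩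
    have := M.theta_pos hA (l + 1)
    simpa [curve] using this
  · rintro ⟨-, h, -⟩
    exact lt_irrefl _ ((M.scaled_lt_iff one_pos).1 h)

end RodModel

theorem proposition3p4 (p : ReactionParams) (hk : 0 < p.k) :
    ((p.k * p.fu + p.gv) ^ 2 - 4 * p.k * (p.fu * p.gv - p.fv * p.gu) > 0 →
      MovesDownwards (EPlus p) ∧ MovesDownwards (OPlus p)) ∧
    (p.fu + p.gv < 0 →
      ∀ l : ℕ, EMinus p (l + 1) ⊂ EMinus p l ∧ OMinus p (l + 1) ⊂ OMinus p l) := by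
  refine ⟨fun hdisc => ?_, fun hsum l => ?_⟩
  · have hab : p.a < p.b := by
      have h : 0 < √p.disc := Real.sqrt_pos.2 hdisc
      exact div_lt_div_of_pos_right (by linarith) (by linarith)
    exact ⟨evenModel.movesDownwards hab, oddModel.movesDownwards hab⟩
  · have hA : p.A < 0 := div_neg_of_neg_of_pos hsum (by linarith)
    exact ⟨evenModel.ssubset_succ hA l, oddModel.ssubset_succ hA l⟩
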